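/- Let $\boldsymbol f=(f_1,\dots,f_m)$ be a sequence of polynomials in $\mathbb Q[\boldsymbol y][\boldsymbol x]$, with parameters $\boldsymbol y=(y_1,\dots,y_t)$ and variables $\boldsymbol x=(x_1,\dots,x_n)$, and assume that there is a non-empty Zariski open set $\mathcal O\subset\mathbb C^t$ such that for every $\eta\in\mathcal O$ the system $\boldsymbol f(\eta,\cdot)=0$ has a non-empty finite set of solutions in $\mathbb C^n$. Let $\mathbb K=\mathbb Q(\boldsymbol y)$ and let $\langle\boldsymbol f\rangle_{\mathbb K}$ be the ideal generated by $\boldsymbol f$ in $\mathbb K[\boldsymbol x]$. Let $\mathcal G$ be the reduced Gröbner basis of $\langle\boldsymbol f\rangle\subset\mathbb Q[\boldsymbol x,\boldsymbol y]$ for the elimination (block) order $\mathrm{grevlex}(\boldsymbol x)\succ\mathrm{grevlex}(\boldsymbol y)$. For $g\in\mathcal G$ let $\mathrm{lm}_{\boldsymbol x}(g)$ and $\mathrm{lc}_{\boldsymbol x}(g)\in\mathbb Q[\boldsymbol y]$ be its leading monomial and leading coefficient as a polynomial in $\boldsymbol x$ for $\mathrm{grevlex}(\boldsymbol x)$. Let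 $\mathcal W_\infty=\bigcup_{g\in\mathcal G}V(\mathrm{lc}_{\boldsymbol x}(g))\subset\mathbb C^t$, and let $\mathcal B$ be the set of monomials in $\boldsymbol x$ that are divisible by no $\mathrm{lm}_{\boldsymbol x}(g)$, $g\in\mathcal G$. For a field $F$, an ideal $I\subset F[\boldsymbol x]$ and a finite set $\mathcal B$ of monomials whose classes form a basis of $F[\boldsymbol x]/I$, the Hermite matrix of $I$ with respect to $\mathcal B$ is the matrix indexed by $\mathcal B\times\mathcal B$ whose $(b,c)$ entry is the trace of the multiplication by $bc$ on $F[\boldsymbol x]/I$. Then $\mathcal B$ is finite and its classes form a basis of $\mathbb K[\boldsymbol x]/\langle\boldsymbol f\rangle_{\mathbb K}$. Let $\mathcal H$ be the Hermite matrix of $\langle\boldsymbol f\rangle_{\mathbb K}$ with respect to $\mathcal B$ (the parametric Hermite matrix of $\boldsymbol f$). 1. For every $\eta\in\mathbb C^t\setminus\mathcal W_\infty$: the ideal $\langle\boldsymbol f(\eta,\cdot)\rangle\subset\mathbb C[\boldsymbol x]$ is zero-dimensional (its zero set is finite and non-empty), the classes of $\mathcal B$ form a basis of $\mathbb C[\boldsymbol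 x]/\langle\boldsymbol f(\eta,\cdot)\rangle$, all entries of $\mathcal H$ are defined at $\eta$, and the specialization $\mathcal H(\eta)$ equals the Hermite matrix of $\langle\boldsymbol f(\eta,\cdot)\rangle$ with respect to $\mathcal B$. Moreover, the rank of $\mathcal H(\eta)$ is the number of distinct roots of $\boldsymbol f(\eta,\cdot)$ in $\mathbb C^n$. 2. For every $\eta\in\mathbb R^t\setminus\mathcal W_\infty$, the signature of $\mathcal H(\eta)$ (number of positive minus number of negative squares) is the number of distinct roots of $\boldsymbol f(\eta,\cdot)$ in $\mathbb R^n$. -/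

import Mathlib

open MvPolynomial

noncomputable section

/-! ### Monomial orders -/

/-- A type synonym for exponent vectors of monomials in `n` variables, carrying the graded
reverse lexicographic order. -/
def GrevLex (n : ℕ) : Type := Fin n →₀ ℕ

namespace GrevLex

variable {n : ℕ}

instance instAddCommMonoid : AddCommMonoid (GrevLex n) :=
  inferInstanceAs (AddCommMonoid (Fin n →₀ ℕ))

/-- The identity map. -/
def of : (Fin n →₀ ℕ) ≃+ GrevLex n := AddEquiv.refl _

/-- The sort key of the grevlex order: first the total degree; ties are broken by comparing the
exponent vectors lexicographically, starting from the last variable, in the opposite order. -/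
def key (a : GrevLex n) : ℕ ×ₗ (Lex (Fin n → ℕ))ᵒᵈ :=
  toLex ((of.symm a).degree, OrderDual.toDual (toLex fun i : Fin n => of.symm a i.rev))

theorem key_injective : Function.Injective (key : GrevLex n → _) := by
  intro a b h
  have h2 : (fun i : Fin n => of.symm a i.rev) = fun i : Fin n => of.symm b i.rev :=
    congrArg (fun x : ℕ ×ₗ (Lex (Fin n → ℕ))ᵒᵈ => ofLex (OrderDual.ofDual (ofLex x).2)) h
  refine of.symm.injective (Finsupp.ext fun i => ?_)
  have := congrFun h2 i.rev
  simpa using this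

instance instLinearOrder : LinearOrder (GrevLex n) :=
  LinearOrder.lift' key key_injective

theorem lt_iff {a b : Fin n →₀ ℕ} :
    of a < of b ↔
      a.degree < b.degree ∨
        (a.degree = b.degree ∧ ∃ i, (∀ j, i < j → a j = b j) ∧ b i < a i) := by
  change key (of a) < key (of b) ↔ _
  unfold key
  rw [Prod.Lex.toLex_lt_toLex]
  refine or_congr Iff.rfl (and_congr Iff.rfl ?_)
  rw [OrderDual.toDual_lt_toDual]
  constructor
  · rintro ⟨i, h1, h2⟩
    refine ⟨i.rev, fun j hj => ?_, h2⟩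
    have h3 : j.rev < i := by
      rw [← Fin.rev_lt_rev, Fin.rev_rev]
      exact hj
    simpa using (h1 j.rev h3).symm
  · rintro ⟨i, h1, h2⟩
    refine ⟨i.rev, fun j hj => ?_, ?_⟩
    · have h3 : i < j.rev := by
        rw [← Fin.rev_lt_rev, Fin.rev_rev]
        exact hj
      simpa using (h1 j.rev h3).symm
    · simpa using h2

instance instIsOrderedAddMonoid : IsOrderedAddMonoid (GrevLex n) where
  add_le_add_left a b h c := by
    obtain ⟨a, rfl⟩ := of.surjective a
    obtain ⟨b, rfl⟩ := of.surjective b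
    obtain ⟨c, rfl⟩ := of.surjective c
    rcases h.eq_or_lt with h | h
    · rw [h]
    · refine le_of_lt ?_
      rw [← map_add, ← map_add, lt_iff]
      simpa using lt_iff.1 h

theorem zero_le_of (a : Fin n →₀ ℕ) : 0 ≤ of a := by
  by_contra h
  have h' : of a < of 0 := by simpa using h
  rcases lt_iff.1 h' with h1 | ⟨h1, i, -, h2⟩
  · simp at h1
  · have h0 : a = 0 := (Finsupp.degree_eq_zero_iff _).1 (by simpa using h1)
    simp [h0] at h2

theorem monotone_of : Monotone (of : (Fin n →₀ ℕ) → GrevLex n) := by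
  intro a b h
  obtain ⟨c, rfl⟩ := exists_add_of_le h
  rw [map_add]
  exact le_add_of_nonneg_right (zero_le_of c)

instance instWellFoundedLT : WellFoundedLT (GrevLex n) := by
  have : WellQuasiOrderedLE (GrevLex n) :=
    monotone_of.wellQuasiOrderedLE_of_wellQuasiOrderedLE_of_surjective of.surjective
  exact inferInstance

end GrevLex

/-- The graded reverse lexicographic monomial order with `X 0 ≻ X 1 ≻ ⋯ ≻ X (n - 1)`. -/
def grevlex (n : ℕ) : MonomialOrder (Fin n) where
  syn := GrevLex n
  toSyn := GrevLex.of
  toSyn_monotone := GrevLex.monotone_of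

open scoped MonomialOrder in
/-- The usual description: `a ≺ b` iff `|a| < |b|`, or `|a| = |b|` and the last nonzero entry of
`b - a` is negative. -/
theorem grevlex_lt_iff {n : ℕ} {a b : Fin n →₀ ℕ} :
    a ≺[grevlex n] b ↔
      a.degree < b.degree ∨
        (a.degree = b.degree ∧ ∃ i, (∀ j, i < j → a j = b j) ∧ b i < a i) :=
  GrevLex.lt_iff

/-- The elimination (block) order on the monomials in two blocks of variables: compare the
first block with `m₁`, and break ties by comparing the second block with `m₂`. -/
def blockOrder {σ τ : Type*} (m₁ : MonomialOrder σ) (m₂ : MonomialOrder τ) :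
    MonomialOrder (σ ⊕ τ) where
  syn := m₁.syn ×ₗ m₂.syn
  toSyn :=
    { toFun := fun a =>
        toLex (m₁.toSyn (Finsupp.sumFinsuppAddEquivProdFinsupp a).1,
          m₂.toSyn (Finsupp.sumFinsuppAddEquivProdFinsupp a).2)
      invFun := fun p => Finsupp.sumFinsuppAddEquivProdFinsupp.symm
        (m₁.toSyn.symm (ofLex p).1, m₂.toSyn.symm (ofLex p).2)
      left_inv := fun a => by simp
      right_inv := fun p => by simp
      map_add' := fun a b => by rw [map_add, Prod.fst_add, Prod.snd_add, map_add, map_add]; rfl }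
  toSyn_monotone := fun a b h => by
    have h1 : (Finsupp.sumFinsuppAddEquivProdFinsupp a).1
        ≤ (Finsupp.sumFinsuppAddEquivProdFinsupp b).1 := fun i => h (Sum.inl i)
    have h2 : (Finsupp.sumFinsuppAddEquivProdFinsupp a).2
        ≤ (Finsupp.sumFinsuppAddEquivProdFinsupp b).2 := fun i => h (Sum.inr i)
    exact Prod.Lex.toLex_mono ⟨m₁.toSyn_monotone h1, m₂.toSyn_monotone h2⟩

/-! ### Gröbner bases -/

section Groebner

variable {σ k : Type*} [Field k]

/-- `G` is a Gröbner basis of `I`: it generates `I`, and the leading monomials of its elements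
generate the initial ideal of `I`. -/
def IsGroebnerBasis (m : MonomialOrder σ) (I : Ideal (MvPolynomial σ k))
    (G : Set (MvPolynomial σ k)) : Prop :=
  Ideal.span G = I ∧
    Ideal.span {q | ∃ g ∈ G, g ≠ 0 ∧ q = monomial (m.degree g) (1 : k)} =
      Ideal.span {q | ∃ p ∈ I, p ≠ 0 ∧ q = monomial (m.degree p) (1 : k)}

/-- `G` is the reduced Gröbner basis of `I`: a Gröbner basis consisting of monic polynomials such
that no term of an element `g` of `G` is divisible by the leading monomial of another element.
(For finitely many variables, such a set is automatically finite.) -/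
def IsReducedGroebnerBasis (m : MonomialOrder σ) (I : Ideal (MvPolynomial σ k))
    (G : Set (MvPolynomial σ k)) : Prop :=
  IsGroebnerBasis m I G ∧
    ∀ g ∈ G, m.Monic g ∧
      ∀ h ∈ G, h ≠ g → ∀ d ∈ g.support, ¬ m.degree h ≤ d

/-- Every ideal has a reduced Gröbner basis. -/
theorem exists_isReducedGroebnerBasis [Finite σ] (m : MonomialOrder σ)
    (I : Ideal (MvPolynomial σ k)) : ∃ G, IsReducedGroebnerBasis m I G := by
  classical
  let S : Set (σ →₀ ℕ) := {d | ∃ p ∈ I, p ≠ 0 ∧ m.degree p = d}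
  let M : Set (σ →₀ ℕ) := {d | Minimal (· ∈ S) d}
  have hMle : ∀ d ∈ S, ∃ e ∈ M, e ≤ d := by
    intro d hd
    obtain ⟨e, he, hm⟩ := exists_minimal_le_of_wellFoundedLT (· ∈ S) d hd
    exact ⟨e, hm, he⟩
  let D : Set (MvPolynomial σ k) := {p | p ∈ I ∧ p ≠ 0}
  have hD : ∀ b ∈ D, IsUnit (m.leadingCoeff b) := fun b hb =>
    (m.leadingCoeff_ne_zero_iff.2 hb.2).isUnit
  have key : ∀ d ∈ S, ∃ g ∈ I, m.Monic g ∧ m.degree g = d ∧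
      ∀ e ∈ g.support, e ≠ d → e ∉ S := by
    intro d hd
    obtain ⟨q, r, h1, h2, h3⟩ := m.div_set hD (monomial d (1 : k))
    have hrS : ∀ e ∈ r.support, e ∉ S := by
      rintro e he ⟨p, hp, hp0, rfl⟩
      exact h3 _ he p ⟨hp, hp0⟩ le_rfl
    have hrd : r.coeff d = 0 := by
      by_contra h
      exact hrS d (mem_support_iff.2 h) hd
    have hg : monomial d (1 : k) - r ∈ I := by
      rw [h1, add_sub_cancel_right, Finsupp.linearCombination_apply]
      refine Ideal.sum_mem _ fun b _ => ?_
      exact I.mul_mem_left _ b.2.1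
    have hcd : (monomial d (1 : k) - r).coeff d = 1 := by simp [hrd]
    have hrdeg : m.toSyn (m.degree r) ≤ m.toSyn d := by
      have hr : r = monomial d (1 : k) - Finsupp.linearCombination _
          (fun b : D => (b : MvPolynomial σ k)) q := by
        rw [h1]; ring
      rw [hr]
      refine le_trans m.degree_sub_le (sup_le (m.degree_monomial_le 1) ?_)
      rw [Finsupp.linearCombination_apply]
      refine le_trans m.degree_sum_le (Finset.sup_le fun b _ => ?_)
      change m.toSyn (m.degree (q b * (b : MvPolynomial σ k))) ≤ _
      rw [mul_comm]
      exact (h2 b).trans (m.degree_monomial_le 1)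
    have hdeg : m.degree (monomial d (1 : k) - r) = d := by
      apply m.toSyn.injective
      apply le_antisymm
      · exact le_trans m.degree_sub_le (sup_le (m.degree_monomial_le 1) hrdeg)
      · exact m.le_degree (mem_support_iff.2 (by rw [hcd]; exact one_ne_zero))
    refine ⟨_, hg, ?_, hdeg, ?_⟩
    · unfold MonomialOrder.Monic MonomialOrder.leadingCoeff
      rw [hdeg, hcd]
    · intro e he hed
      apply hrS e
      rw [mem_support_iff] at he ⊢
      rw [coeff_sub, coeff_monomial, if_neg (Ne.symm hed)] at he
      simpa using he
  choose! g hgI hgM hgd hgS using key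
  have hgne : ∀ d ∈ S, g d ≠ 0 := fun d hd => (hgM d hd).ne_zero
  have hdiv : ∀ p ∈ I, p ≠ 0 → ∃ e ∈ M, m.degree (g e) ≤ m.degree p := by
    intro p hp hp0
    obtain ⟨e, he, hle⟩ := hMle _ ⟨p, hp, hp0, rfl⟩
    exact ⟨e, he, by rwa [hgd e he.1]⟩
  refine ⟨g '' M, ⟨le_antisymm ?_ ?_, le_antisymm ?_ ?_⟩, ?_⟩
  · rw [Ideal.span_le]
    rintro _ ⟨d, hd, rfl⟩
    exact hgI d hd.1
  · intro p hp
    have hu : ∀ b ∈ g '' M, IsUnit (m.leadingCoeff b) := by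
      rintro _ ⟨d, hd, rfl⟩
      exact (m.leadingCoeff_ne_zero_iff.2 (hgne d hd.1)).isUnit
    obtain ⟨q, r, h1, -, h3⟩ := m.div_set hu p
    have hq : Finsupp.linearCombination _ (fun b : g '' M => (b : MvPolynomial σ k)) q
        ∈ Ideal.span (g '' M) := by
      rw [Finsupp.linearCombination_apply]
      exact Ideal.sum_mem _ fun b _ => Ideal.mul_mem_left _ _ (Ideal.subset_span b.2)
    have hle : Ideal.span (g '' M) ≤ I := by
      rw [Ideal.span_le]
      rintro _ ⟨d, hd, rfl⟩
      exact hgI d hd.1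
    have hr : r ∈ I := by
      have : r = p - Finsupp.linearCombination _ (fun b : g '' M => (b : MvPolynomial σ k)) q := by
        rw [h1]; ring
      rw [this]
      exact I.sub_mem hp (hle hq)
    have hr0 : r = 0 := by
      by_contra h0
      obtain ⟨e, he, hle⟩ := hdiv r hr h0
      exact h3 _ (m.degree_mem_support h0) _ ⟨e, he, rfl⟩ hle
    rw [h1, hr0, add_zero]
    exact hq
  · refine Ideal.span_mono ?_
    rintro _ ⟨_, ⟨d, hd, rfl⟩, h0, rfl⟩
    exact ⟨g d, hgI d hd.1, h0, rfl⟩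
  · rw [Ideal.span_le]
    rintro _ ⟨p, hp, hp0, rfl⟩
    obtain ⟨e, he, hle⟩ := hdiv p hp hp0
    obtain ⟨c, hc⟩ := exists_add_of_le hle
    have : monomial (m.degree p) (1 : k)
        = monomial c 1 * monomial (m.degree (g e)) 1 := by
      rw [monomial_mul, hc, add_comm, one_mul]
    rw [this]
    exact Ideal.mul_mem_left _ _ (Ideal.subset_span ⟨g e, ⟨e, he, rfl⟩, hgne e he.1, rfl⟩)
  · rintro _ ⟨d, hd, rfl⟩
    refine ⟨hgM d hd.1, ?_⟩
    rintro _ ⟨e, he, rfl⟩ hne c hc hle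
    rw [hgd e he.1] at hle
    have hed : e ≠ d := fun h => hne (by rw [h])
    by_cases hcd : c = d
    · rw [hcd] at hle
      exact hed (le_antisymm hle (hd.2 he.1 hle))
    · refine hgS d hd.1 c hc hcd ?_
      obtain ⟨p, hp, hp0, rfl⟩ := he.1
      obtain ⟨a, rfl⟩ := exists_add_of_le hle
      refine ⟨monomial a 1 * p, I.mul_mem_left _ hp, ?_, ?_⟩
      · exact mul_ne_zero (by simp) hp0
      · rw [m.degree_mul (by simp) hp0, m.degree_monomial, if_neg one_ne_zero, add_comm]

end Groebner

/-! ### Hermite matrices -/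

/-- The family of monomials with exponents in `B` is a basis of the vector space `K[x]/I`. -/
def IsMonomialBasis {n : ℕ} {K : Type*} [Field K] (I : Ideal (MvPolynomial (Fin n) K))
    (B : Set (Fin n →₀ ℕ)) : Prop :=
  LinearIndependent K (fun d : B => Ideal.Quotient.mk I (monomial d.1 (1 : K))) ∧
    Submodule.span K (Set.range fun d : B => Ideal.Quotient.mk I (monomial d.1 (1 : K))) = ⊤

/-- The Hermite matrix of `I` with respect to the monomials with exponents in `B`: its `(b, c)`
entry is the trace of the multiplication by `b * c` on `K[x]/I`. -/
def hermiteMatrix {n : ℕ} {K : Type*} [Field K] (I : Ideal (MvPolynomial (Fin n) K))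
    (B : Set (Fin n →₀ ℕ)) : Matrix B B K :=
  Matrix.of fun b c =>
    LinearMap.trace K (MvPolynomial (Fin n) K ⧸ I)
      (LinearMap.mulLeft K
        (Ideal.Quotient.mk I (monomial b.1 (1 : K) * monomial c.1 (1 : K))))

/-- The signature (number of positive squares minus number of negative squares) of a real
symmetric matrix. -/
def matrixSignature {ι : Type*} [Fintype ι] (A : Matrix ι ι ℝ) : ℤ :=
  letI := Classical.decEq ι
  (sigPos A.toQuadraticForm' : ℤ) - (sigNeg A.toQuadraticForm' : ℤ)

/-! ### Parametric systems -/

/-- `ℚ[y][x]` with `t` parameters `y` and `n` variables `x`. -/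
abbrev ParamPoly (t n : ℕ) : Type := MvPolynomial (Fin n) (MvPolynomial (Fin t) ℚ)

/-- The field `ℚ(y)`. -/
abbrev ParamField (t : ℕ) : Type := FractionRing (MvPolynomial (Fin t) ℚ)

section Parametric

variable {t n m : ℕ}

/-- A polynomial of `ℚ[y][x]` seen in `ℚ[x, y]`. -/
def flatten (p : ParamPoly t n) : MvPolynomial (Fin n ⊕ Fin t) ℚ :=
  (sumAlgEquiv ℚ (Fin n) (Fin t)).symm p

/-- The elimination order `grevlex(x) ≻ grevlex(y)`. -/
def elimOrder (t n : ℕ) : MonomialOrder (Fin n ⊕ Fin t) :=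
  blockOrder (grevlex n) (grevlex t)

/-- The ideal `⟨f⟩` of `ℚ[x, y]`. -/
def totalIdeal (f : Fin m → ParamPoly t n) : Ideal (MvPolynomial (Fin n ⊕ Fin t) ℚ) :=
  Ideal.span (Set.range fun i => flatten (f i))

/-- The ideal `⟨f⟩_𝕂` of `𝕂[x]`, where `𝕂 = ℚ(y)`. -/
def genericIdeal (f : Fin m → ParamPoly t n) : Ideal (MvPolynomial (Fin n) (ParamField t)) :=
  Ideal.span (Set.range fun i =>
    MvPolynomial.map (algebraMap (MvPolynomial (Fin t) ℚ) (ParamField t)) (f i))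

variable {F : Type*} [Field F] [Algebra ℚ F]

/-- The specialization `p(η, ·)` of `p ∈ ℚ[y][x]` at a point `η`. -/
def specialize (η : Fin t → F) (p : ParamPoly t n) : MvPolynomial (Fin n) F :=
  MvPolynomial.map (aeval η : MvPolynomial (Fin t) ℚ →ₐ[ℚ] F).toRingHom p

/-- The ideal `⟨f(η, ·)⟩` of `F[x]`. -/
def specializedIdeal (f : Fin m → ParamPoly t n) (η : Fin t → F) :
    Ideal (MvPolynomial (Fin n) F) :=
  Ideal.span (Set.range fun i => specialize η (f i))

/-- The set of (distinct) roots of `f(η, ·)` in `F ^ n`. -/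
def systemRoots (f : Fin m → ParamPoly t n) (η : Fin t → F) : Set (Fin n → F) :=
  {x | ∀ i, eval x (specialize η (f i)) = 0}

/-- The rational function `h ∈ ℚ(y)` is defined at `η`: its denominator in lowest terms does not
vanish there. -/
def IsDefinedAt (η : Fin t → F) (h : ParamField t) : Prop :=
  aeval η (IsFractionRing.den (MvPolynomial (Fin t) ℚ) h : MvPolynomial (Fin t) ℚ) ≠ 0

/-- The value `h(η)` of a rational function `h ∈ ℚ(y)` that is defined at `η`. -/
def evalFrac (η : Fin t → F) (h : ParamField t) : F :=
  aeval η (IsFractionRing.num (MvPolynomial (Fin t) ℚ) h) /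
    aeval η (IsFractionRing.den (MvPolynomial (Fin t) ℚ) h : MvPolynomial (Fin t) ℚ)

/-- A subset of `ℂ ^ t` is Zariski open if it is the complement of an algebraic set. -/
def IsZariskiOpen (O : Set (Fin t → ℂ)) : Prop :=
  ∃ J : Ideal (MvPolynomial (Fin t) ℂ), O = (zeroLocus ℂ J)ᶜ

/-- Over a non-empty Zariski open set of parameters, `f(η, ·)` has a non-empty finite set of
complex roots. -/
def IsGenericallyFinite (f : Fin m → ParamPoly t n) : Prop :=
  ∃ O : Set (Fin t → ℂ), IsZariskiOpen O ∧ O.Nonempty ∧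
    ∀ η ∈ O, (systemRoots f η).Nonempty ∧ (systemRoots f η).Finite

/-- `𝒢` is the reduced Gröbner basis of `⟨f⟩ ⊆ ℚ[x, y]` for the order
`grevlex(x) ≻ grevlex(y)`; its elements are regarded as elements of `ℚ[y][x]`. -/
def IsParametricGB (f : Fin m → ParamPoly t n) (𝒢 : Set (ParamPoly t n)) : Prop :=
  IsReducedGroebnerBasis (elimOrder t n) (totalIdeal f) (flatten '' 𝒢)

theorem exists_isParametricGB (f : Fin m → ParamPoly t n) : ∃ 𝒢, IsParametricGB f 𝒢 := by
  obtain ⟨G, hG⟩ := exists_isReducedGroebnerBasis (elimOrder t n) (totalIdeal f)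
  refine ⟨flatten ⁻¹' G, ?_⟩
  have hs : Function.Surjective (flatten : ParamPoly t n → _) :=
    (sumAlgEquiv ℚ (Fin n) (Fin t)).symm.surjective
  unfold IsParametricGB
  rwa [Set.image_preimage_eq G hs]

/-- The set `𝓑` of (exponents of) monomials in `x` that are not divisible by the leading monomial
in `x` of any element of `𝒢`. -/
def standardMonomials (𝒢 : Set (ParamPoly t n)) : Set (Fin n →₀ ℕ) :=
  {d | ∀ g ∈ 𝒢, ¬ (grevlex n).degree g ≤ d}

/-- The union of the zero sets in `ℂ ^ t` of the leading coefficients `lc_x(g) ∈ ℚ[y]`,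
`g ∈ 𝒢`. -/
def WInfty (𝒢 : Set (ParamPoly t n)) : Set (Fin t → ℂ) :=
  {η | ∃ g ∈ 𝒢, aeval η ((grevlex n).leadingCoeff g) = 0}

/-- The parametric Hermite matrix `𝓗` of `f` with respect to the standard monomials of `𝒢`. -/
def paramHermite (f : Fin m → ParamPoly t n) (𝒢 : Set (ParamPoly t n)) :
    Matrix (standardMonomials 𝒢) (standardMonomials 𝒢) (ParamField t) :=
  hermiteMatrix (genericIdeal f) (standardMonomials 𝒢)

end Parametric

end

open MvPolynomial

noncomputable section

/-! The generic fibre and the fibre at `η` are compared through a common integral model. Let `R` be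
the localization of `ℚ[y]` at the products of the leading coefficients `lc_x(g)`. For the block
order, the leading monomial restricts to `lm_x`, so every nonzero element of `⟨f⟩` has its
`x`-leading monomial divisible by some `lm_x(g)`. Over `R` the `lc_x(g)` are units: division by `𝒢`
shows that the standard monomials span `R[x]/⟨f⟩`, and clearing denominators shows that they are
independent (`exists_localBasis`). A monomial basis survives every base change, and traces of
multiplications are carried along (`specializedBasis`, `trace_mulLeft_map`). Applied to `R → ℚ(y)`
and to `R → F` given by `η`, this exhibits each entry of `𝓗` and the corresponding entry at `η` as
images of one element of `R`. The reduced denominator of such an entry divides a product of leading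
coefficients, so it does not vanish at `η` (`isDefinedAt_and_evalFrac_eq`).

Finiteness and non-emptiness of `𝓑` are read off at a single point of `O` where no `lc_x(g)`
vanishes, using the Nullstellensatz; as the same `𝓑` is a basis at every other admissible `η`, they
transfer there.

For the root counts, `exists_trace_eq_sum` writes the trace of multiplication by `p` as `∑ μ_v p(v)`
over the complex zeros, with `μ_v > 0`. Hence the Hermite matrix is `Aᵀ D A`, with `D` the diagonal
of the `μ_v` and `A` an evaluation matrix having a right inverse, so its rank is the number of
zeros. Over `ℝ`, suitable real coordinates turn the quadratic form into `∑ μ_v r(v) r(v̄)`. It is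
positive definite on conjugation-invariant `r` and negative definite on anti-invariant `r`; the
dimensions of these two spaces add up to the number of complex zeros and differ by the number of
real ones. -/

/-! ### Specialization of monomial bases -/

section BaseChange

variable {σ R F : Type*} [CommRing R] [CommRing F] (φ : R →+* F) {I : Ideal (MvPolynomial σ R)}
  {B : Set (σ →₀ ℕ)} (b : Module.Basis B R (MvPolynomial σ R ⧸ I))

/-- The coordinates of the monomials with respect to `b`, specialized by `φ` and extended
linearly. -/
def specializedCoord : MvPolynomial σ F →ₗ[F] (B →₀ F) :=
  (basisMonomials σ F).constr F fun d =>
    (b.repr (Ideal.Quotient.mk I (monomial d 1))).mapRange φ φ.map_zero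

theorem specializedCoord_monomial (d : σ →₀ ℕ) :
    specializedCoord φ b (monomial d 1) =
      (b.repr (Ideal.Quotient.mk I (monomial d 1))).mapRange φ φ.map_zero := by
  have := (basisMonomials σ F).constr_basis F (fun d =>
    (b.repr (Ideal.Quotient.mk I (monomial d 1))).mapRange φ φ.map_zero) d
  rwa [coe_basisMonomials] at this

/-- Both sides are additive and `φ`-semilinear in `p`, and they agree on monomials by construction.
-/
theorem specializedCoord_map (p : MvPolynomial σ R) :
    specializedCoord φ b (map φ p) =
      (b.repr (Ideal.Quotient.mk I p)).mapRange φ φ.map_zero := by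
  induction p using MvPolynomial.induction_on' with
  | monomial d a =>
    have h1 : (monomial d a : MvPolynomial σ R) = a • monomial d 1 := by simp [smul_monomial]
    have h2 : (monomial d (φ a) : MvPolynomial σ F) = φ a • monomial d 1 := by simp [smul_monomial]
    have h3 : Ideal.Quotient.mk I (a • monomial d (1 : R)) =
      a • Ideal.Quotient.mk I (monomial d (1 : R)) := rfl
    rw [map_monomial, h2, map_smul, specializedCoord_monomial, h1, h3, map_smul]
    ext; simp
  | add p q hp hq =>
    rw [map_add, map_add, hp, hq, map_add, map_add]
    ext; simp

/-- The coordinate map is only `F`-linear, so the induction over the ideal carries an arbitrary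
multiplier `r`. For a generator `map φ p` and a monomial `r`, the product is a scalar times the
image of an element of `I`, whose coordinates vanish. -/
theorem specializedCoord_eq_zero {q : MvPolynomial σ F} (hq : q ∈ I.map (map φ)) :
    specializedCoord φ b q = 0 := by
  suffices h : ∀ r : MvPolynomial σ F, specializedCoord φ b (r * q) = 0 by simpa using h 1
  refine Submodule.span_induction (p := fun q _ => ∀ r : MvPolynomial σ F,
    specializedCoord φ b (r * q) = 0) ?_ ?_ ?_ ?_ hq
  · rintro _ ⟨p, hp, rfl⟩ r
    induction r using MvPolynomial.induction_on' with
    | monomial d a =>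
      have h : (monomial d a : MvPolynomial σ F) * map φ p = a • map φ (monomial d 1 * p) := by
        rw [map_mul, map_monomial, map_one, ← smul_mul_assoc, smul_monomial, smul_eq_mul, mul_one]
      have h0 : Ideal.Quotient.mk I (monomial d 1 * p) = 0 :=
        Ideal.Quotient.eq_zero_iff_mem.2 (I.mul_mem_left _ hp)
      rw [h, map_smul, specializedCoord_map, h0]
      ext; simp
    | add r s hr hs => rw [add_mul, map_add, hr, hs, add_zero]
  · simp
  · intro x y _ _ hx hy r
    rw [mul_add, map_add, hx, hy, add_zero]
  · intro a x _ hx r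
    rw [smul_eq_mul, ← mul_assoc, hx]

/-- The coordinates of the classes modulo the specialized ideal. -/
def specializedRepr : (MvPolynomial σ F ⧸ I.map (map φ)) →ₗ[F] (B →₀ F) :=
  ((I.map (map φ)).restrictScalars F).liftQ (specializedCoord φ b) fun _ hq =>
    specializedCoord_eq_zero φ b hq

theorem specializedRepr_mk (q : MvPolynomial σ F) :
    specializedRepr φ b (Ideal.Quotient.mk _ q) = specializedCoord φ b q :=
  rfl

variable {b}

/-- It suffices to treat monomials: the relation expressing a monomial through `B` modulo `I` is
pushed forward by `φ` to the same relation modulo the extended ideal. -/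
theorem sum_specializedCoord (hb : ∀ d, b d = Ideal.Quotient.mk I (monomial d.1 1))
    (q : MvPolynomial σ F) :
    Finsupp.linearCombination F
      (fun d : B => Ideal.Quotient.mk (I.map (map φ)) (monomial d.1 (1 : F)))
      (specializedCoord φ b q) = Ideal.Quotient.mk (I.map (map φ)) q := by
  suffices h : (Finsupp.linearCombination F
      (fun d : B => Ideal.Quotient.mk (I.map (map φ)) (monomial d.1 (1 : F)))) ∘ₗ
      specializedCoord φ b = (Ideal.Quotient.mkₐ F (I.map (map φ))).toLinearMap from
    LinearMap.congr_fun h q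
  refine (basisMonomials σ F).ext fun d => ?_
  rw [coe_basisMonomials, LinearMap.comp_apply, specializedCoord_monomial,
    AlgHom.toLinearMap_apply, Ideal.Quotient.mkₐ_eq_mk]
  set c := b.repr (Ideal.Quotient.mk I (monomial d 1)) with hc
  have h1 : monomial d 1 - c.sum (fun e a => C a * monomial e.1 1) ∈ I := by
    rw [← Ideal.Quotient.eq_zero_iff_mem, map_sub, sub_eq_zero]
    conv_lhs => rw [← b.linearCombination_repr (Ideal.Quotient.mk I (monomial d 1)), ← hc]
    rw [Finsupp.linearCombination_apply, Finsupp.sum, Finsupp.sum, map_sum]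
    refine Finset.sum_congr rfl fun e _ => ?_
    rw [hb, C_mul', ← Ideal.Quotient.mkₐ_eq_mk R, map_smul]
  have h2 := Ideal.mem_map_of_mem (map φ) h1
  rw [map_sub, ← Ideal.Quotient.eq_zero_iff_mem, map_sub, sub_eq_zero] at h2
  rw [map_monomial, map_one] at h2
  rw [h2, Finsupp.linearCombination_apply, Finsupp.sum_mapRange_index (by simp), Finsupp.sum,
    Finsupp.sum, map_sum, map_sum]
  refine Finset.sum_congr rfl fun e _ => ?_
  have h3 : map φ (C (c e) * monomial e.1 1) = φ (c e) • monomial e.1 1 := by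
    simp [C_mul_monomial, smul_monomial]
  rw [h3]
  rfl

theorem specializedRepr_linearCombination
    (hb : ∀ d, b d = Ideal.Quotient.mk I (monomial d.1 1)) (c : B →₀ F) :
    specializedRepr φ b (Finsupp.linearCombination F
      (fun d : B => Ideal.Quotient.mk (I.map (map φ)) (monomial d.1 (1 : F))) c) = c := by
  rw [Finsupp.linearCombination_apply, Finsupp.sum, map_sum]
  conv_rhs => rw [← Finsupp.sum_single c, Finsupp.sum]
  refine Finset.sum_congr rfl fun d _ => ?_
  rw [map_smul, specializedRepr_mk, specializedCoord_monomial, ← hb, b.repr_self]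
  simp

variable (b) in
/-- A basis of monomials of `R[x]/I` stays a basis after any base change `R → F`. -/
def specializedBasis (hb : ∀ d, b d = Ideal.Quotient.mk I (monomial d.1 1)) :
    Module.Basis B F (MvPolynomial σ F ⧸ I.map (map φ)) :=
  .ofRepr
    { specializedRepr φ b with
      invFun := Finsupp.linearCombination F
        (fun d : B => Ideal.Quotient.mk (I.map (map φ)) (monomial d.1 (1 : F)))
      left_inv := fun q => by
        obtain ⟨q, rfl⟩ := Ideal.Quotient.mk_surjective q
        exact sum_specializedCoord φ hb q
      right_inv := specializedRepr_linearCombination φ hb }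

theorem specializedBasis_apply (hb : ∀ d, b d = Ideal.Quotient.mk I (monomial d.1 1)) (d : B) :
    specializedBasis φ b hb d = Ideal.Quotient.mk _ (monomial d.1 1) := by
  change Finsupp.linearCombination F
      (fun d : B => Ideal.Quotient.mk (I.map (map φ)) (monomial d.1 (1 : F)))
      (Finsupp.single d 1) = _
  rw [Finsupp.linearCombination_single, one_smul]

theorem specializedBasis_repr (hb : ∀ d, b d = Ideal.Quotient.mk I (monomial d.1 1))
    (p : MvPolynomial σ R) :
    (specializedBasis φ b hb).repr (Ideal.Quotient.mk _ (map φ p)) =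
      (b.repr (Ideal.Quotient.mk I p)).mapRange φ φ.map_zero :=
  specializedCoord_map φ b p

/-- The trace of a multiplication map commutes with base change. -/
theorem trace_mulLeft_map [Finite B] (hb : ∀ d, b d = Ideal.Quotient.mk I (monomial d.1 1))
    (p : MvPolynomial σ R) :
    LinearMap.trace F _ (LinearMap.mulLeft F (Ideal.Quotient.mk (I.map (map φ)) (map φ p))) =
      φ (LinearMap.trace R _ (LinearMap.mulLeft R (Ideal.Quotient.mk I p))) := by
  classical
  have := Fintype.ofFinite B
  rw [LinearMap.trace_eq_matrix_trace F (specializedBasis φ b hb),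
    LinearMap.trace_eq_matrix_trace R b, Matrix.trace, Matrix.trace, map_sum]
  refine Finset.sum_congr rfl fun d _ => ?_
  rw [Matrix.diag_apply, Matrix.diag_apply, LinearMap.toMatrix_apply, LinearMap.toMatrix_apply,
    LinearMap.mulLeft_apply, LinearMap.mulLeft_apply, specializedBasis_apply, hb,
    ← map_mul, ← map_mul]
  have : map φ p * monomial d.1 1 = map φ (p * monomial d.1 1) := by
    rw [map_mul, map_monomial, φ.map_one]
  rw [this, specializedBasis_repr, Finsupp.mapRange_apply]

end BaseChange

theorem isMonomialBasis_of_basis {n : ℕ} {K : Type*} [Field K] {I : Ideal (MvPolynomial (Fin n) K)}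
    {B : Set (Fin n →₀ ℕ)} (b : Module.Basis B K (MvPolynomial (Fin n) K ⧸ I))
    (hb : ∀ d, b d = Ideal.Quotient.mk I (monomial d.1 1)) : IsMonomialBasis I B := by
  have h : (fun d : B => Ideal.Quotient.mk I (monomial d.1 (1 : K))) = b := funext fun d => (hb d).symm
  unfold IsMonomialBasis
  rw [h]
  exact ⟨b.linearIndependent, b.span_eq⟩

/-! ### Leading monomials for the elimination order -/

section Elimination

variable {t n m : ℕ}

theorem flatten_ne_zero {p : ParamPoly t n} (hp : p ≠ 0) : flatten p ≠ 0 := by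
  unfold flatten
  rwa [Ne, EmbeddingLike.map_eq_zero_iff]

theorem coeff_sumAlgEquiv {R σ τ : Type*} [CommSemiring R] (q : MvPolynomial (σ ⊕ τ) R)
    (s : σ ⊕ τ →₀ ℕ) :
    ((sumAlgEquiv R σ τ q).coeff (Finsupp.sumFinsuppAddEquivProdFinsupp s).1).coeff
      (Finsupp.sumFinsuppAddEquivProdFinsupp s).2 = q.coeff s := by
  classical
  induction q using MvPolynomial.induction_on' with
  | monomial u a =>
    have h : sumAlgEquiv R σ τ (monomial u a) =
        monomial (Finsupp.sumFinsuppAddEquivProdFinsupp u).1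
          (monomial (Finsupp.sumFinsuppAddEquivProdFinsupp u).2 a) := by
      ext; simp [sumAlgEquiv, monomial, coeff]
    rw [h, coeff_monomial, coeff_monomial]
    by_cases hu : u = s
    · simp [hu]
    · rw [if_neg hu]
      split_ifs with h1
      · rw [coeff_monomial, if_neg]
        exact fun h2 => hu (Finsupp.sumFinsuppAddEquivProdFinsupp.injective (Prod.ext h1 h2))
      · simp
  | add p q hp hq => rw [map_add, coeff_add, coeff_add, coeff_add, hp, hq]

theorem coeff_flatten (p : ParamPoly t n) (s : Fin n ⊕ Fin t →₀ ℕ) :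
    (flatten p).coeff s =
      (p.coeff (Finsupp.sumFinsuppAddEquivProdFinsupp s).1).coeff
        (Finsupp.sumFinsuppAddEquivProdFinsupp s).2 := by
  rw [← coeff_sumAlgEquiv, flatten, AlgEquiv.apply_symm_apply]

/-- The leading monomial for the elimination order restricts to the leading monomial in the first
block of variables. -/
theorem fst_degree_flatten {p : ParamPoly t n} (hp : p ≠ 0) :
    (Finsupp.sumFinsuppAddEquivProdFinsupp ((elimOrder t n).degree (flatten p))).1 =
      (grevlex n).degree p := by
  apply (grevlex n).toSyn.injective
  apply le_antisymm
  · apply (grevlex n).le_degree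
    have h := (elimOrder t n).degree_mem_support (flatten_ne_zero hp)
    rw [mem_support_iff, coeff_flatten] at h
    rw [mem_support_iff]
    intro h0
    exact h (by rw [h0, coeff_zero])
  · have hlc : (grevlex n).leadingCoeff p ≠ 0 := (grevlex n).leadingCoeff_ne_zero_iff.2 hp
    obtain ⟨e, he⟩ := ne_zero_iff.1 hlc
    -- The `x`-leading monomial times any monomial `e` of its coefficient occurs in `flatten p`,
    -- which bounds the block-order leading monomial from below.
    set s := Finsupp.sumFinsuppAddEquivProdFinsupp.symm ((grevlex n).degree p, e) with hs
    have hs' : Finsupp.sumFinsuppAddEquivProdFinsupp s = ((grevlex n).degree p, e) := by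
      rw [hs, AddEquiv.apply_symm_apply]
    have hmem : s ∈ (flatten p).support := by
      rw [mem_support_iff, coeff_flatten, hs']
      exact he
    have h := (elimOrder t n).le_degree hmem
    have h1 := Prod.Lex.monotone_fst _ _ h
    change (grevlex n).toSyn (Finsupp.sumFinsuppAddEquivProdFinsupp s).1 ≤ _ at h1
    rwa [hs'] at h1

end Elimination

/-! ### Parametric Gröbner bases -/

namespace IsParametricGB

variable {t n m : ℕ} {f : Fin m → ParamPoly t n} {𝒢 : Set (ParamPoly t n)}

theorem span_eq (h : IsParametricGB f 𝒢) : Ideal.span 𝒢 = Ideal.span (Set.range f) := by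
  have h1 := h.1.1
  let e : ParamPoly t n ≃ₐ[ℚ] _ := (sumAlgEquiv ℚ (Fin n) (Fin t)).symm
  have h2 : Ideal.map (e : ParamPoly t n →+* MvPolynomial (Fin n ⊕ Fin t) ℚ) (Ideal.span 𝒢) =
      Ideal.map (e : ParamPoly t n →+* MvPolynomial (Fin n ⊕ Fin t) ℚ) (Ideal.span (Set.range f)) := by
    rw [Ideal.map_span, Ideal.map_span, ← Set.range_comp]
    exact h1
  have hinj : Function.Injective (Ideal.map (e : ParamPoly t n →+* MvPolynomial (Fin n ⊕ Fin t) ℚ)) :=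
    fun I J hIJ => by
      have := congrArg (Ideal.comap (e : ParamPoly t n →+* MvPolynomial (Fin n ⊕ Fin t) ℚ)) hIJ
      have hb : Function.Bijective (e : ParamPoly t n →+* MvPolynomial (Fin n ⊕ Fin t) ℚ) := e.bijective
      rwa [Ideal.comap_map_of_bijective _ hb, Ideal.comap_map_of_bijective _ hb] at this
  exact hinj h2

theorem ne_zero (h : IsParametricGB f 𝒢) {g : ParamPoly t n} (hg : g ∈ 𝒢) : g ≠ 0 := by
  rintro rfl
  exact (h.2 _ ⟨0, hg, rfl⟩).1.ne_zero (by simp [flatten])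

/-- The leading monomial in `x` of an element of the ideal is divisible by the leading monomial of
an element of the Gröbner basis. -/
theorem exists_degree_le (h : IsParametricGB f 𝒢) {p : ParamPoly t n}
    (hp : p ∈ Ideal.span (Set.range f)) (hp0 : p ≠ 0) :
    ∃ g ∈ 𝒢, (grevlex n).degree g ≤ (grevlex n).degree p := by
  have hpI : flatten p ∈ totalIdeal f := by
    have := Ideal.mem_map_of_mem 
      ((sumAlgEquiv ℚ (Fin n) (Fin t)).symm : ParamPoly t n →+* MvPolynomial (Fin n ⊕ Fin t) ℚ) hp
    rw [Ideal.map_span, ← Set.range_comp] at this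
    exact this
  have h1 : monomial ((elimOrder t n).degree (flatten p)) (1 : ℚ) ∈
      Ideal.span {q | ∃ g ∈ flatten '' 𝒢, g ≠ 0 ∧
        q = monomial ((elimOrder t n).degree g) (1 : ℚ)} := by
    rw [h.1.2]
    exact Ideal.subset_span ⟨_, hpI, flatten_ne_zero hp0, rfl⟩
  have h2 : {q | ∃ g ∈ flatten '' 𝒢, g ≠ 0 ∧ q = monomial ((elimOrder t n).degree g) (1 : ℚ)} ⊆
      (fun s => monomial s (1 : ℚ)) '' ((fun g => (elimOrder t n).degree (flatten g)) '' 𝒢) := by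
    rintro _ ⟨_, ⟨g, hg, rfl⟩, -, rfl⟩
    exact ⟨_, ⟨g, hg, rfl⟩, rfl⟩
  obtain ⟨_, ⟨g, hg, rfl⟩, hle⟩ := mem_ideal_span_monomial_image.1 (Ideal.span_mono h2 h1)
    ((elimOrder t n).degree (flatten p)) (by simp [mem_support_iff])
  refine ⟨g, hg, ?_⟩
  -- Divisibility in all variables restricts to divisibility in `x`.
  rw [← fst_degree_flatten hp0, ← fst_degree_flatten (h.ne_zero hg)]
  exact fun i => hle (Sum.inl i)

/-- By reducedness, distinct elements have incomparable leading exponents; by Dickson's lemma an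
antichain of exponents is finite. -/
theorem finite (h : IsParametricGB f 𝒢) : 𝒢.Finite := by
  have hinj : Set.InjOn (fun g : ParamPoly t n => (elimOrder t n).degree (flatten g)) 𝒢 := by
    intro g hg k hk hgk
    by_contra hne
    refine (h.2 _ ⟨g, hg, rfl⟩).2 _ ⟨k, hk, rfl⟩ (fun e => hne ?_) _
      ((elimOrder t n).degree_mem_support (flatten_ne_zero (h.ne_zero hg))) hgk.ge
    exact ((sumAlgEquiv ℚ (Fin n) (Fin t)).symm.injective e).symm
  refine Set.Finite.of_finite_image (WellQuasiOrderedLE.finite_of_isAntichain ?_) hinj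
  rintro _ ⟨g, hg, rfl⟩ _ ⟨k, hk, rfl⟩ hne hle
  refine (h.2 _ ⟨k, hk, rfl⟩).2 _ ⟨g, hg, rfl⟩ (fun e => hne (by simp only [e])) _
      ((elimOrder t n).degree_mem_support (flatten_ne_zero (h.ne_zero hk))) hle

end IsParametricGB

/-- The multiplicative set generated by the leading coefficients in `x`. -/
def leadingSubmonoid {t n : ℕ} (𝒢 : Set (ParamPoly t n)) : Submonoid (MvPolynomial (Fin t) ℚ) :=
  Submonoid.closure ((grevlex n).leadingCoeff '' 𝒢)

/-! ### Standard monomials over the localization at the leading coefficients -/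

namespace IsParametricGB

variable {t n m : ℕ} {f : Fin m → ParamPoly t n} {𝒢 : Set (ParamPoly t n)}

theorem leadingSubmonoid_le (h : IsParametricGB f 𝒢) :
    leadingSubmonoid 𝒢 ≤ nonZeroDivisors (MvPolynomial (Fin t) ℚ) := by
  refine Submonoid.closure_le.2 ?_
  rintro _ ⟨g, hg, rfl⟩
  exact mem_nonZeroDivisors_of_ne_zero ((grevlex n).leadingCoeff_ne_zero_iff.2 (h.ne_zero hg))

variable (R : Type*) [CommRing R] [Algebra (MvPolynomial (Fin t) ℚ) R]

variable (f) in
/-- The ideal generated by the system over an extension of the ring of coefficients. -/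
def _root_.localIdeal : Ideal (MvPolynomial (Fin n) R) :=
  (Ideal.span (Set.range f)).map (map (algebraMap (MvPolynomial (Fin t) ℚ) R))

variable [IsLocalization (leadingSubmonoid 𝒢) R]

/-- Clearing denominators gives a nonzero `a = s p` in the ideal over `ℚ[y]`, supported within the
support of `p`. Its leading monomial is divisible by some `lm_x(g)`, hence is not standard. This
yields linear independence. -/
theorem eq_zero_of_support_subset (h : IsParametricGB f 𝒢)
    {p : MvPolynomial (Fin n) R} (hp : p ∈ localIdeal f R)
    (hs : ∀ d ∈ p.support, d ∈ standardMonomials 𝒢) : p = 0 := by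
  by_contra hp0
  have hle := h.leadingSubmonoid_le
  have hinj : Function.Injective (algebraMap (MvPolynomial (Fin t) ℚ) R) :=
    IsLocalization.injective _ hle
  -- `R[x]` is the localization of `ℚ[y][x]` at the constants coming from the submonoid.
  let := algebraMvPolynomial (R := MvPolynomial (Fin t) ℚ) (S := R) (σ := Fin n)
  obtain ⟨⟨⟨a, ha⟩, ⟨_, s, hs', rfl⟩⟩, hx⟩ := (IsLocalization.mem_map_algebraMap_iff
    ((leadingSubmonoid 𝒢).map (C (σ := Fin n))) (MvPolynomial (Fin n) R)).1 hp
  simp only [algebraMap_def, map_C] at hx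
  have hu : IsUnit (algebraMap (MvPolynomial (Fin t) ℚ) R s) :=
    IsLocalization.map_units R (⟨s, hs'⟩ : leadingSubmonoid 𝒢)
  have hsupp : ∀ d, a.coeff d ≠ 0 → p.coeff d ≠ 0 := by
    intro d hd h0
    have h1 := congrArg (coeff d) hx
    rw [mul_comm, coeff_C_mul, h0, mul_zero, coeff_map] at h1
    exact hd (hinj (by rw [← h1, map_zero]))
  have ha0 : a ≠ 0 := by
    rintro rfl
    rw [map_zero] at hx
    exact hp0 ((hu.map C).mul_left_eq_zero.1 hx)
  obtain ⟨g, hg, hgle⟩ := h.exists_degree_le ha ha0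
  refine hs ((grevlex n).degree a) (mem_support_iff.2 (hsupp _ ?_)) g hg hgle
  exact mem_support_iff.1 ((grevlex n).degree_mem_support ha0)

theorem _root_.MonomialOrder.degree_map_of_isUnit {R k σ : Type*} [CommRing R] [CommRing k]
    [Nontrivial k] (mo : MonomialOrder σ) (φ : R →+* k) {g : MvPolynomial σ R} (hu : IsUnit (φ (mo.leadingCoeff g))) :
    mo.degree (map φ g) = mo.degree g := by
  apply mo.toSyn.injective
  apply le_antisymm
  · rw [mo.degree_le_iff]
    intro d hd
    exact mo.le_degree (support_map_subset φ g hd)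
  · apply mo.le_degree
    rw [mem_support_iff, coeff_map]
    exact hu.ne_zero

/-- The leading coefficients are units in `R` and the leading monomials persist there, so the
division algorithm by `𝒢` runs over `R`. This yields spanning. -/
theorem exists_standard_remainder (h : IsParametricGB f 𝒢)
    (p : MvPolynomial (Fin n) R) :
    ∃ r, p - r ∈ localIdeal f R ∧ ∀ d ∈ r.support, d ∈ standardMonomials 𝒢 := by
  have hinj : Function.Injective (algebraMap (MvPolynomial (Fin t) ℚ) R) :=
    IsLocalization.injective _ h.leadingSubmonoid_le
  have : Nontrivial R := hinj.nontrivial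
  set ψ := algebraMap (MvPolynomial (Fin t) ℚ) R with hψ
  have hu : ∀ g ∈ 𝒢, IsUnit (ψ ((grevlex n).leadingCoeff g)) := fun g hg =>
    IsLocalization.map_units R
      (⟨_, Submonoid.subset_closure ⟨g, hg, rfl⟩⟩ : leadingSubmonoid 𝒢)
  obtain ⟨q, r, h1, -, h3⟩ := (grevlex n).div_set (B := map ψ '' 𝒢) (by
    rintro _ ⟨g, hg, rfl⟩
    rw [MonomialOrder.leadingCoeff, MonomialOrder.degree_map_of_isUnit _ _ (hu g hg), coeff_map]
    exact hu g hg) p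
  refine ⟨r, ?_, fun d hd g hg => ?_⟩
  · rw [h1, add_sub_cancel_right (Finsupp.linearCombination _ _ q) r,
      Finsupp.linearCombination_apply]
    refine Ideal.sum_mem _ fun b _ => Ideal.mul_mem_left _ _ ?_
    obtain ⟨_, g, hg, rfl⟩ := b
    refine Ideal.mem_map_of_mem _ ?_
    rw [← h.span_eq]
    exact Ideal.subset_span hg
  · rw [← MonomialOrder.degree_map_of_isUnit _ ψ (hu g hg)]
    exact h3 d hd _ ⟨g, hg, rfl⟩

/-- The standard monomials form a basis over the ring of fractions. -/
theorem exists_localBasis (h : IsParametricGB f 𝒢) :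
    ∃ b : Module.Basis (standardMonomials 𝒢) R
        (MvPolynomial (Fin n) R ⧸ localIdeal f R),
      ∀ d, b d = Ideal.Quotient.mk _ (monomial d.1 1) := by
  refine ⟨Module.Basis.mk (v := fun d : standardMonomials 𝒢 =>
    Ideal.Quotient.mk (localIdeal f R) (monomial d.1 1)) ?_ ?_, fun d => Module.Basis.mk_apply _ _ d⟩
  · have hli : LinearIndependent R
        fun d : standardMonomials 𝒢 => (monomial d.1 1 : MvPolynomial (Fin n) R) := by
      have := (basisMonomials (Fin n) R).linearIndependent.comp _
        (Subtype.val_injective (p := (· ∈ standardMonomials 𝒢)))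
      rwa [coe_basisMonomials] at this
    refine hli.map (f := (Ideal.Quotient.mkₐ R (localIdeal f R)).toLinearMap) ?_
    rw [Submodule.disjoint_def]
    intro p hp hp0
    refine h.eq_zero_of_support_subset R (Ideal.Quotient.eq_zero_iff_mem.1 hp0) ?_
    have hle : Submodule.span R (Set.range fun d : standardMonomials 𝒢 =>
        (monomial d.1 1 : MvPolynomial (Fin n) R)) ≤ restrictSupport R (standardMonomials 𝒢) := by
      rw [Submodule.span_le]
      rintro _ ⟨d, rfl⟩
      exact (mem_restrictSupport_iff _).2 fun e he =>
        Finset.mem_singleton.1 (support_monomial_subset he) ▸ d.2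
    exact fun d hd => (mem_restrictSupport_iff _).1 (hle hp) hd
  · rintro q -
    obtain ⟨p, rfl⟩ := Ideal.Quotient.mk_surjective q
    obtain ⟨r, h1, h2⟩ := h.exists_standard_remainder R p
    rw [(Ideal.Quotient.mk_eq_mk_iff_sub_mem p r).2 h1, r.as_sum, map_sum]
    refine Submodule.sum_mem _ fun d hd => ?_
    have : Ideal.Quotient.mk (localIdeal f R) (monomial d (r.coeff d)) =
        r.coeff d • Ideal.Quotient.mk (localIdeal f R) (monomial d 1) := by
      rw [← Ideal.Quotient.mkₐ_eq_mk R, ← map_smul, smul_monomial, smul_eq_mul, mul_one]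
    rw [this]
    exact Submodule.smul_mem _ _ (Submodule.subset_span ⟨⟨d, h2 d hd⟩, rfl⟩)

end IsParametricGB

/-! ### Zero-dimensional ideals over an algebraically closed field -/

section ZeroDimensional

variable {σ k : Type*} [Field k]

/-- Lagrange interpolation: for each `u ≠ v`, a coordinate separating the two points gives a linear
factor vanishing at `u` and equal to `1` at `v`. -/
theorem exists_indicator_polynomial {V : Set (σ → k)} (hV : V.Finite) (v : σ → k) :
    ∃ q : MvPolynomial σ k, eval v q = 1 ∧ ∀ u ∈ V, u ≠ v → eval u q = 0 := by
  classical
  choose i hi using fun (u : σ → k) (hu : u ≠ v) => Function.ne_iff.1 hu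
  refine ⟨∏ u ∈ (hV.toFinset.erase v).attach,
    (C ((v (i u.1 (Finset.ne_of_mem_erase u.2)) - u.1 (i u.1 (Finset.ne_of_mem_erase u.2)))⁻¹) *
      (X (i u.1 (Finset.ne_of_mem_erase u.2)) - C (u.1 (i u.1 (Finset.ne_of_mem_erase u.2))))),
    ?_, ?_⟩
  · rw [map_prod]
    refine Finset.prod_eq_one fun u _ => ?_
    simp only [map_mul, eval_C, map_sub, eval_X]
    exact inv_mul_cancel₀ (sub_ne_zero.2 (hi u.1 (Finset.ne_of_mem_erase u.2)).symm)
  · intro u hu huv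
    rw [map_prod]
    refine Finset.prod_eq_zero (Finset.mem_attach _
      ⟨u, Finset.mem_erase.2 ⟨huv, hV.mem_toFinset.2 hu⟩⟩) ?_
    simp

theorem exists_interpolation {V : Set (σ → k)} (hV : V.Finite) (c : (σ → k) → k) :
    ∃ p : MvPolynomial σ k, ∀ v ∈ V, eval v p = c v := by
  classical
  choose q hq1 hq0 using exists_indicator_polynomial hV
  refine ⟨∑ u ∈ hV.toFinset, C (c u) * q u, fun v hv => ?_⟩
  rw [map_sum, Finset.sum_eq_single v]
  · simp [hq1]
  · intro u _ huv
    simp [hq0 u v hv huv.symm]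
  · intro h
    exact absurd (hV.mem_toFinset.2 hv) h

theorem eval_eq_of_mk_eq {I : Ideal (MvPolynomial σ k)} {p q : MvPolynomial σ k}
    (h : Ideal.Quotient.mk I p = Ideal.Quotient.mk I q) {v : σ → k} (hv : v ∈ zeroLocus k I) :
    eval v p = eval v q := by
  have := hv _ (Ideal.Quotient.eq.1 h)
  rwa [aeval_eq_eval, map_sub, sub_eq_zero] at this

variable {I : Ideal (MvPolynomial σ k)}

/-- Each coordinate is integral over `k` modulo `I`, so its values at the zeros are roots of one
monic polynomial. -/
theorem finite_zeroLocus [Finite σ] [Module.Finite k (MvPolynomial σ k ⧸ I)] :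
    (zeroLocus k I).Finite := by
  have hint : ∀ i, IsIntegral k (Ideal.Quotient.mk I (X i)) := fun i =>
    Algebra.IsIntegral.isIntegral _
  choose P hP hP0 using hint
  refine (Set.Finite.pi' (t := fun i => {a : k | (P i).IsRoot a}) fun i =>
    Polynomial.finite_setOfPred_isRoot (hP i).ne_zero).subset fun v hv i => ?_
  have h : Ideal.Quotient.mk I (Polynomial.aeval (X i) (P i)) = Ideal.Quotient.mk I 0 := by
    rw [map_zero, ← Ideal.Quotient.mkₐ_eq_mk k, ← Polynomial.aeval_algHom_apply]
    exact hP0 i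
  have h1 := eval_eq_of_mk_eq h hv
  rw [map_zero, ← aeval_eq_eval, ← Polynomial.aeval_algHom_apply, aeval_X] at h1
  exact h1

variable [IsAlgClosed k] [Finite σ]

/-- This is Hilbert's Nullstellensatz, in the form in which it is used below. -/
theorem isNilpotent_mk_of_forall_eval_eq_zero {p : MvPolynomial σ k}
    (h : ∀ v ∈ zeroLocus k I, eval v p = 0) : IsNilpotent (Ideal.Quotient.mk I p) := by
  have : p ∈ I.radical := by
    rw [← vanishingIdeal_zeroLocus_eq_radical (K := k)]
    exact fun v hv => by rw [aeval_eq_eval]; exact h v hv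
  obtain ⟨N, hN⟩ := this
  exact ⟨N, by rw [← map_pow]; exact Ideal.Quotient.eq_zero_iff_mem.2 hN⟩

theorem zeroLocus_nonempty_iff : (zeroLocus k I).Nonempty ↔ I ≠ ⊤ := by
  constructor
  · rintro ⟨v, hv⟩ rfl
    simpa using hv 1 trivial
  · intro h
    by_contra h0
    have h1 := isNilpotent_mk_of_forall_eval_eq_zero (I := I) (p := 1) fun v hv =>
      absurd ⟨v, hv⟩ h0
    obtain ⟨N, hN⟩ := h1
    rw [map_one, one_pow, ← map_one (Ideal.Quotient.mk I), Ideal.Quotient.eq_zero_iff_mem] at hN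
    exact h ((Ideal.eq_top_iff_one I).2 hN)

/-- For each `i`, the product of the `X i - v i` over the zeros `v` vanishes on the zero locus, so a
power of it lies in `I`. Thus the quotient is generated by finitely many integral elements. -/
theorem finite_quotient_of_finite_zeroLocus (h : (zeroLocus k I).Finite) :
    Module.Finite k (MvPolynomial σ k ⧸ I) := by
  have hint : ∀ i, IsIntegral k (Ideal.Quotient.mk I (X i)) := by
    intro i
    set P : Polynomial k := ∏ v ∈ h.toFinset, (Polynomial.X - Polynomial.C (v i)) with hP
    have hPm : P.Monic := Polynomial.monic_prod_of_monic _ _ fun v _ => Polynomial.monic_X_sub_C _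
    obtain ⟨N, hN⟩ := isNilpotent_mk_of_forall_eval_eq_zero (I := I)
      (p := Polynomial.aeval (X i) P) (by
        intro v hv
        rw [← aeval_eq_eval, ← Polynomial.aeval_algHom_apply, aeval_X, hP,
          map_prod]
        exact Finset.prod_eq_zero (h.mem_toFinset.2 hv) (by simp))
    refine ⟨P ^ N, hPm.pow N, ?_⟩
    change Polynomial.aeval (Ideal.Quotient.mkₐ k I (X i)) (P ^ N) = 0
    rw [Polynomial.aeval_algHom_apply, map_pow, map_pow]
    exact hN
  have hfg := fg_adjoin_of_finite (R := k) (Set.finite_range fun i => Ideal.Quotient.mkₐ k I (X i))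
    (by rintro _ ⟨i, rfl⟩; exact hint i)
  have htop : Algebra.adjoin k (Set.range fun i => Ideal.Quotient.mkₐ k I (X i)) = ⊤ := by
    have := congrArg (Subalgebra.map (Ideal.Quotient.mkₐ k I)) (adjoin_range_X (R := k) (σ := σ))
    rw [AlgHom.map_adjoin, ← Set.range_comp, Algebra.map_top,
      (AlgHom.range_eq_top _).2 (Ideal.Quotient.mkₐ_surjective k I)] at this
    exact this
  rw [htop] at hfg
  exact ⟨hfg⟩

/-- The trace of the multiplication by `p` is the sum of the values of `p` at the points of the
zero locus, counted with positive multiplicities. -/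
theorem exists_trace_eq_sum [CharZero k] [Module.Finite k (MvPolynomial σ k ⧸ I)]
    [Fintype (zeroLocus k I)] :
    ∃ μ : zeroLocus k I → ℕ, (∀ v, 0 < μ v) ∧ ∀ p : MvPolynomial σ k,
      LinearMap.trace k _ (LinearMap.mulLeft k (Ideal.Quotient.mk I p)) =
        ∑ v, (μ v : k) * eval v.1 p := by
  have hV : (zeroLocus k I).Finite := Set.toFinite _
  have key : ∀ v : zeroLocus k I, ∃ e : MvPolynomial σ k,
      IsIdempotentElem (Ideal.Quotient.mk I e) ∧ eval v.1 e = 1 ∧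
        ∀ u ∈ zeroLocus k I, u ≠ v.1 → eval u e = 0 := by
    intro v
    obtain ⟨q, hq1, hq0⟩ := exists_indicator_polynomial hV v.1
    have hnil : IsNilpotent (Ideal.Quotient.mk I (q * q - q)) := by
      refine isNilpotent_mk_of_forall_eval_eq_zero fun u hu => ?_
      by_cases huv : u = v.1
      · simp [huv, hq1]
      · simp [hq0 u hu huv]
    let N := nilradical (MvPolynomial σ k ⧸ I)
    -- The indicator of `v` is idempotent modulo nilpotents; lifting through the nilradical gives a
    -- true idempotent with the same values at the zeros.
    obtain ⟨e, he, hef⟩ := exists_isIdempotentElem_eq_of_ker_isNilpotent (Ideal.Quotient.mk N)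
      (fun x hx => by rwa [Ideal.mk_ker, mem_nilradical] at hx)
      (Ideal.Quotient.mk N (Ideal.Quotient.mk I q)) ⟨_, rfl⟩ (by
        unfold IsIdempotentElem
        rw [← map_mul, ← map_mul, Ideal.Quotient.eq, ← map_sub]
        exact mem_nilradical.2 hnil)
    obtain ⟨e, rfl⟩ := Ideal.Quotient.mk_surjective e
    have hev : ∀ u ∈ zeroLocus k I, eval u e = eval u q := by
      intro u hu
      obtain ⟨M, hM⟩ := mem_nilradical.1 (Ideal.Quotient.eq.1 hef)
      rw [← map_sub, ← map_pow, ← map_zero (Ideal.Quotient.mk I)] at hM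
      have := eval_eq_of_mk_eq hM hu
      rw [map_zero, map_pow] at this
      have := eq_zero_of_pow_eq_zero this
      rwa [map_sub, sub_eq_zero] at this
    exact ⟨e, he, by rw [hev v.1 v.2, hq1], fun u hu huv => by rw [hev u hu, hq0 u hu huv]⟩
  choose e he he1 he0 using key
  have hid : ∀ v, IsIdempotentElem (Algebra.lmul k _ (Ideal.Quotient.mk I (e v))) := fun v =>
    (he v).map _
  -- The trace of a projection is the dimension of its range; this dimension serves as the
  -- multiplicity of `v`.
  have htr : ∀ v, Algebra.trace k _ (Ideal.Quotient.mk I (e v)) =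
      (Module.finrank k (LinearMap.range (Algebra.lmul k _ (Ideal.Quotient.mk I (e v)))) : k) :=
    fun v => (LinearMap.IsIdempotentElem.isProj_range _ (hid v)).trace
  refine ⟨fun v => Module.finrank k
    (LinearMap.range (Algebra.lmul k _ (Ideal.Quotient.mk I (e v)))), fun v => ?_, fun p => ?_⟩
  · refine Nat.pos_of_ne_zero fun h0 => ?_
    rw [Submodule.finrank_eq_zero, LinearMap.range_eq_bot] at h0
    have h1 := LinearMap.congr_fun h0 1
    rw [LinearMap.zero_apply, Algebra.coe_lmul_eq_mul, LinearMap.mul_apply', mul_one, ← map_zero (Ideal.Quotient.mk I)] at h1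
    have := eval_eq_of_mk_eq h1 v.2
    rw [he1, map_zero] at this
    exact one_ne_zero this
  · change Algebra.trace k _ (Ideal.Quotient.mk I p) = _
    -- Modulo nilpotents, which have trace zero, `p` is the combination of the idempotents weighted
    -- by its values.
    have hnil : IsNilpotent (Ideal.Quotient.mk I (p - ∑ v, C (eval v.1 p) * e v)) := by
      refine isNilpotent_mk_of_forall_eval_eq_zero fun u hu => ?_
      rw [map_sub, map_sum, Finset.sum_eq_single ⟨u, hu⟩]
      · simp [he1 ⟨u, hu⟩]
      · intro v _ hv
        have : u ≠ v.1 := fun h => hv (Subtype.ext h.symm)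
        simp [he0 v u hu this]
      · simp
    have h0 := (Algebra.isNilpotent_trace_of_isNilpotent (R := k) hnil).eq_zero
    rw [map_sub, map_sub, sub_eq_zero] at h0
    rw [h0, map_sum, map_sum]
    refine Finset.sum_congr rfl fun v _ => ?_
    rw [C_mul', ← htr, mul_comm, ← smul_eq_mul, ← map_smul]
    rfl

end ZeroDimensional

/-! ### Signatures -/

section Signature

variable {𝕜 M E : Type*} [Field 𝕜] [LinearOrder 𝕜] [AddCommGroup M] [Module 𝕜 M]
  [AddCommGroup E] [Module 𝕜 E] [FiniteDimensional 𝕜 M] [FiniteDimensional 𝕜 E]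

/-- Positive definite subspaces of maximal dimension move both ways: `L` is injective on one
upstairs, since the pulled-back form vanishes on its kernel, and a linear section of `L` lifts one
from downstairs. -/
theorem sigPos_comp_of_surjective (q : QuadraticForm 𝕜 E) {L : M →ₗ[𝕜] E}
    (hL : Function.Surjective L) : sigPos (q.comp L) = sigPos q := by
  apply le_antisymm
  · obtain ⟨V, hV, hpos⟩ := exists_finrank_eq_sigPos_and_posDef (q.comp L)
    have hinj : Function.Injective (L.domRestrict V) := by
      rw [← LinearMap.ker_eq_bot, LinearMap.ker_eq_bot']
      intro x hx
      by_contra hx0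
      have h1 := hpos x hx0
      have h2 : L x = 0 := hx
      rw [QuadraticMap.restrict_apply, QuadraticMap.comp_apply, h2, QuadraticMap.map_zero] at h1
      exact lt_irrefl _ h1
    rw [← hV, ← LinearMap.finrank_range_of_inj hinj]
    refine le_sigPos_of_posDef q ?_
    rintro ⟨_, x, rfl⟩ hx
    exact hpos x (fun h => hx (by simp [h]))
  · obtain ⟨V, hV, hpos⟩ := exists_finrank_eq_sigPos_and_posDef q
    obtain ⟨g, hg⟩ := L.exists_rightInverse_of_surjective (LinearMap.range_eq_top.2 hL)
    have hg' : ∀ x, L (g x) = x := fun x => LinearMap.congr_fun hg x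
    have hginj : Function.Injective g := Function.LeftInverse.injective hg'
    rw [← hV, (Submodule.equivMapOfInjective g hginj V).finrank_eq]
    refine le_sigPos_of_posDef _ ?_
    rintro ⟨_, x, hx, rfl⟩ hx0
    rw [QuadraticMap.restrict_apply, QuadraticMap.comp_apply, hg']
    exact hpos ⟨x, hx⟩ (fun h => hx0 (by
      have : x = 0 := congrArg Subtype.val h
      simp [this]))

theorem sigNeg_comp_of_surjective (q : QuadraticForm 𝕜 E) {L : M →ₗ[𝕜] E}
    (hL : Function.Surjective L) : sigNeg (q.comp L) = sigNeg q :=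
  sigPos_comp_of_surjective (-q) hL

end Signature

/-! ### The quadratic form twisted by an involution -/

section Involution

variable {ι : Type*}

/-- The functions `r` with `r ∘ τ = s * r`. -/
def twistedFunctions (τ : ι → ι) (s : ℝ) : Submodule ℝ (ι → ℝ) :=
  LinearMap.ker (LinearMap.funLeft ℝ ℝ τ - s • LinearMap.id)

theorem mem_twistedFunctions {τ : ι → ι} {s : ℝ} {r : ι → ℝ} :
    r ∈ twistedFunctions τ s ↔ ∀ i, r (τ i) = s * r i := by
  rw [twistedFunctions, LinearMap.mem_ker, funext_iff]
  simp [LinearMap.funLeft_apply, sub_eq_zero]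

variable [Fintype ι] (μ : ι → ℝ) (τ : ι → ι)

/-- The quadratic form `∑ μ i * r i * r (τ i)`. -/
def twistedForm : QuadraticForm ℝ (ι → ℝ) :=
  ∑ i, μ i • QuadraticMap.linMulLin (LinearMap.proj i) (LinearMap.proj (τ i))

theorem twistedForm_apply (r : ι → ℝ) : twistedForm μ τ r = ∑ i, μ i * (r i * r (τ i)) := by
  simp [twistedForm]

variable {μ τ}

theorem twistedForm_posDef (hμ : ∀ i, 0 < μ i) :
    ((twistedForm μ τ).restrict (twistedFunctions τ 1)).PosDef := by
  rintro ⟨r, hr⟩ hr0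
  rw [mem_twistedFunctions] at hr
  obtain ⟨i, hi⟩ : ∃ i, r i ≠ 0 := Function.ne_iff.1 fun h => hr0 (Subtype.ext h)
  rw [QuadraticMap.restrict_apply, twistedForm_apply]
  simp only [hr, one_mul]
  exact Finset.sum_pos' (fun j _ => mul_nonneg (hμ j).le (mul_self_nonneg _))
    ⟨i, Finset.mem_univ i, mul_pos (hμ i) (mul_self_pos.2 hi)⟩

theorem twistedForm_neg_posDef (hμ : ∀ i, 0 < μ i) :
    ((-twistedForm μ τ).restrict (twistedFunctions τ (-1))).PosDef := by
  rintro ⟨r, hr⟩ hr0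
  rw [mem_twistedFunctions] at hr
  obtain ⟨i, hi⟩ : ∃ i, r i ≠ 0 := Function.ne_iff.1 fun h => hr0 (Subtype.ext h)
  rw [QuadraticMap.restrict_apply, neg_apply, twistedForm_apply,
    ← Finset.sum_neg_distrib]
  simp only [hr]
  refine Finset.sum_pos' (fun j _ => ?_) ⟨i, Finset.mem_univ i, ?_⟩
  · nlinarith [mul_nonneg (hμ j).le (mul_self_nonneg (r j))]
  · nlinarith [mul_pos (hμ i) (mul_self_pos.2 hi)]

/-- The operator `(1 + s τ*)/2` projects onto this eigenspace, so its trace is the dimension; `τ*`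
is a permutation matrix, whose trace counts the fixed points. -/
theorem finrank_twistedFunctions (hτ : Function.Involutive τ) {s : ℝ} (hs : s * s = 1) :
    2 * (Module.finrank ℝ (twistedFunctions τ s) : ℝ) =
      Fintype.card ι + s * (Function.fixedPoints τ).ncard := by
  classical
  set p : (ι → ℝ) →ₗ[ℝ] (ι → ℝ) := (2⁻¹ : ℝ) • (LinearMap.id + s • LinearMap.funLeft ℝ ℝ τ) with hp
  have hpa : ∀ r i, p r i = 2⁻¹ * (r i + s * r (τ i)) := fun r i => by
    simp [hp, LinearMap.funLeft_apply, mul_add]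
  have hproj : LinearMap.IsProj (twistedFunctions τ s) p := by
    constructor
    · intro r
      rw [mem_twistedFunctions]
      intro i
      rw [hpa, hpa, hτ i]
      linear_combination (-2⁻¹ * r (τ i)) * hs
    · intro r hr
      rw [mem_twistedFunctions] at hr
      funext i
      rw [hpa, hr i]
      linear_combination (2⁻¹ * r i) * hs
  have h1 : LinearMap.trace ℝ _ (LinearMap.funLeft ℝ ℝ τ) = ((Function.fixedPoints τ).ncard : ℝ) := by
    rw [LinearMap.trace_eq_matrix_trace ℝ (Pi.basisFun ℝ ι), Matrix.trace]
    have : ∀ i, (LinearMap.toMatrix (Pi.basisFun ℝ ι) (Pi.basisFun ℝ ι)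
        (LinearMap.funLeft ℝ ℝ τ)).diag i = if τ i = i then 1 else 0 := by
      intro i
      simp [LinearMap.funLeft_apply, Pi.single_apply]
    rw [Finset.sum_congr rfl fun i _ => this i, Finset.sum_boole, Set.ncard_eq_toFinset_card']
    congr 2
    ext i
    simp [Function.mem_fixedPoints, Function.IsFixedPt]
  rw [← hproj.trace, hp, map_smul, map_add, map_smul, h1, LinearMap.trace_id,
    Module.finrank_fintype_fun_eq_card, smul_eq_mul, smul_eq_mul]
  ring

/-- The signature of the form `∑ μ i * r i * r (τ i)`, `τ` an involution, is the number of fixed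
points of `τ`. -/
theorem sigPos_sub_sigNeg_twistedForm (hμ : ∀ i, 0 < μ i) (hτ : Function.Involutive τ) :
    (sigPos (twistedForm μ τ) : ℤ) - sigNeg (twistedForm μ τ) =
      (Function.fixedPoints τ).ncard := by
  have h1 := finrank_twistedFunctions hτ (s := 1) (by norm_num)
  have h2 := finrank_twistedFunctions hτ (s := -1) (by norm_num)
  have h3 := le_sigPos_of_posDef _ (twistedForm_posDef (τ := τ) hμ)
  have h4 := le_sigNeg_of_negDef _ (twistedForm_neg_posDef (τ := τ) hμ)
  -- The two eigenspaces have dimensions adding up to the whole, so this bound makes both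
  -- inequalities `h3` and `h4` equalities.
  have h5 : sigPos (twistedForm μ τ) + sigNeg (twistedForm μ τ) ≤ Fintype.card ι := by
    have := QuadraticForm.sigPos_add_sigNeg_add_radical (Q := twistedForm μ τ)
    rw [Module.finrank_fintype_fun_eq_card] at this
    omega
  set a := Module.finrank ℝ (twistedFunctions τ 1)
  set b := Module.finrank ℝ (twistedFunctions τ (-1))
  have h6 : a + b = Fintype.card ι := by
    have : (2 * (a + b) : ℝ) = 2 * Fintype.card ι := by linarith
    exact_mod_cast (mul_left_cancel₀ two_ne_zero this)
  have h7 : (a : ℤ) - b = (Function.fixedPoints τ).ncard := by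
    have : (2 * (a - b) : ℝ) = 2 * (Function.fixedPoints τ).ncard := by linarith
    exact_mod_cast (mul_left_cancel₀ two_ne_zero this)
  omega

end Involution

/-! ### Hermite matrices of zero-dimensional ideals -/

section Hermite

theorem zeroLocus_map {σ k K : Type*} [Field k] [Field K] [Algebra k K]
    (I : Ideal (MvPolynomial σ k)) :
    zeroLocus K (I.map (map (algebraMap k K))) = zeroLocus K I := by
  ext v
  constructor
  · intro h p hp
    have := h _ (Ideal.mem_map_of_mem _ hp)
    rwa [aeval_map_algebraMap] at this
  · intro h
    have hle : I.map (map (algebraMap k K)) ≤ vanishingIdeal K {v} := by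
      rw [Ideal.map_le_iff_le_comap]
      intro p hp
      rw [Ideal.mem_comap, mem_vanishingIdeal_iff]
      rintro _ rfl
      rw [aeval_map_algebraMap]
      exact h p hp
    exact fun p hp => hle hp v rfl

variable {n : ℕ} {B : Set (Fin n →₀ ℕ)} [Fintype B]

section

variable {k : Type*} [Field k] {I : Ideal (MvPolynomial (Fin n) k)}

/-- A monomial basis of the quotient, as a basis. -/
def IsMonomialBasis.basis (h : IsMonomialBasis I B) :
    Module.Basis B k (MvPolynomial (Fin n) k ⧸ I) :=
  .mk h.1 h.2.ge

omit [Fintype B] in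
theorem IsMonomialBasis.basis_apply (h : IsMonomialBasis I B) (d : B) :
    h.basis d = Ideal.Quotient.mk I (monomial d.1 1) :=
  Module.Basis.mk_apply _ _ d

theorem IsMonomialBasis.finite (h : IsMonomialBasis I B) :
    Module.Finite k (MvPolynomial (Fin n) k ⧸ I) :=
  .of_basis h.basis

/-- The polynomial with given coefficients at the monomials of `B`. -/
def monomialCombination (k : Type*) [Field k] {n : ℕ} (B : Set (Fin n →₀ ℕ)) [Fintype B] :
    (B → k) →ₗ[k] MvPolynomial (Fin n) k :=
  Fintype.linearCombination k fun b : B => monomial b.1 (1 : k)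

theorem monomialCombination_apply (u : B → k) :
    monomialCombination k B u = ∑ b, u b • monomial b.1 (1 : k) :=
  Fintype.linearCombination_apply ..

theorem IsMonomialBasis.exists_mk_eq (h : IsMonomialBasis I B) (p : MvPolynomial (Fin n) k) :
    ∃ u, Ideal.Quotient.mk I (monomialCombination k B u) = Ideal.Quotient.mk I p := by
  have hp : Ideal.Quotient.mk I p ∈
      Submodule.span k (Set.range fun d : B => Ideal.Quotient.mk I (monomial d.1 (1 : k))) := by
    rw [h.2]
    trivial
  obtain ⟨u, hu⟩ := (Submodule.mem_span_range_iff_exists_fun k).1 hp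
  refine ⟨u, ?_⟩
  rw [← hu, monomialCombination_apply, map_sum]
  rfl

/-- By bilinearity, the Hermite matrix is the Gram matrix of the trace form on the monomials of `B`.
-/
theorem sum_hermiteMatrix (u : B → k) :
    ∑ b, ∑ c, u b * hermiteMatrix I B b c * u c =
      LinearMap.trace k _ (LinearMap.mulLeft k (Ideal.Quotient.mk I
        (monomialCombination k B u * monomialCombination k B u))) := by
  change _ = Algebra.trace k _ (Ideal.Quotient.mk I
        (monomialCombination k B u * monomialCombination k B u))
  rw [monomialCombination_apply, Finset.sum_mul_sum, map_sum, map_sum]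
  refine Finset.sum_congr rfl fun b _ => ?_
  rw [map_sum, map_sum]
  refine Finset.sum_congr rfl fun c _ => ?_
  rw [smul_mul_smul_comm, ← Ideal.Quotient.mkₐ_eq_mk k, map_smul, map_smul, smul_eq_mul]
  change u b * Algebra.trace k _ _ * u c = _
  rw [Ideal.Quotient.mkₐ_eq_mk]
  ring

/-- The rank of the Hermite matrix is the number of points of the zero locus. -/
theorem rank_hermiteMatrix [IsAlgClosed k] [CharZero k] (h : IsMonomialBasis I B) :
    (hermiteMatrix I B).rank = (zeroLocus k I).ncard := by
  classical
  have := h.finite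
  have hV : (zeroLocus k I).Finite := finite_zeroLocus
  have := hV.fintype
  obtain ⟨μ, hμ, htr⟩ := exists_trace_eq_sum (I := I)
  let A : Matrix (zeroLocus k I) B k := .of fun v b => eval v.1 (monomial b.1 1)
  let D : Matrix (zeroLocus k I) (zeroLocus k I) k := .diagonal fun v => (μ v : k)
  have hH : hermiteMatrix I B = A.transpose * (D * A) := by
    ext b c
    rw [hermiteMatrix, Matrix.of_apply, htr, Matrix.mul_apply]
    refine Finset.sum_congr rfl fun v _ => ?_
    rw [Matrix.diagonal_mul, map_mul, Matrix.transpose_apply]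
    simp only [A, Matrix.of_apply]
    ring
  -- Reducing the indicator polynomials to combinations of `B` modulo `I` keeps their values at the
  -- zeros and provides the columns of a right inverse of `A`.
  have hW : ∀ v : zeroLocus k I, ∃ u : B → k, ∀ w : zeroLocus k I,
      ∑ b, eval w.1 (monomial b.1 1) * u b = if w = v then 1 else 0 := by
    intro v
    obtain ⟨q, hq1, hq0⟩ := exists_indicator_polynomial hV v.1
    obtain ⟨u, hu⟩ := h.exists_mk_eq q
    refine ⟨u, fun w => ?_⟩
    have h1 : eval w.1 (monomialCombination k B u) = if w = v then 1 else 0 := by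
      rw [eval_eq_of_mk_eq hu w.2]
      split_ifs with hwv
      · rw [hwv, hq1]
      · exact hq0 _ w.2 fun e => hwv (Subtype.ext e)
    rw [← h1, monomialCombination_apply, map_sum]
    refine Finset.sum_congr rfl fun b _ => ?_
    rw [smul_eval, mul_comm]
  choose u hu using hW
  let W : Matrix B (zeroLocus k I) k := .of fun b v => u v b
  have hAW : A * W = 1 := by
    ext w v
    rw [Matrix.mul_apply, Matrix.one_apply]
    exact hu v w
  have hD : D.rank = (zeroLocus k I).ncard := by
    rw [Matrix.rank_diagonal, ← Nat.card_coe_set_eq, Nat.card_eq_fintype_card]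
    exact Fintype.card_of_subtype Finset.univ (by simp [(hμ _).ne'])
  rw [← hD]
  apply le_antisymm
  · rw [hH]
    exact (Matrix.rank_mul_le_right _ _).trans (Matrix.rank_mul_le_left _ _)
  -- The right inverse recovers `D` from the Hermite matrix, which gives the reverse rank
  -- inequality.
  · have : D = W.transpose * (hermiteMatrix I B * W) := by
      have hAW' : W.transpose * A.transpose = 1 := by
        rw [← Matrix.transpose_mul, hAW, Matrix.transpose_one]
      rw [hH, Matrix.mul_assoc, Matrix.mul_assoc, hAW, Matrix.mul_one, ← Matrix.mul_assoc, hAW',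
        Matrix.one_mul]
    rw [this]
    exact (Matrix.rank_mul_le_right _ _).trans (Matrix.rank_mul_le_left _ _)

end

/-! ### Real ideals and complex conjugation on their zeros -/

section Real

variable {I : Ideal (MvPolynomial (Fin n) ℝ)}

theorem aeval_conj {σ : Type*} (v : σ → ℂ) (p : MvPolynomial σ ℝ) :
    aeval (fun i => starRingEnd ℂ (v i)) p = starRingEnd ℂ (aeval v p) :=
  (comp_aeval_apply v (Complex.conjAe : ℂ →ₐ[ℝ] ℂ) p).symm

/-- Complex conjugation on the complex zero locus of a real ideal. -/
def conjZeroLocus {σ : Type*} (I : Ideal (MvPolynomial σ ℝ)) (v : zeroLocus ℂ I) :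
    zeroLocus ℂ I :=
  ⟨fun i => starRingEnd ℂ (v.1 i), fun p hp => by rw [aeval_conj, v.2 p hp, map_zero]⟩

theorem conjZeroLocus_involutive {σ : Type*} (I : Ideal (MvPolynomial σ ℝ)) :
    Function.Involutive (conjZeroLocus I) := fun v => Subtype.ext (funext fun i => by
  simp [conjZeroLocus])

theorem ncard_fixedPoints_conjZeroLocus {σ : Type*} (I : Ideal (MvPolynomial σ ℝ)) :
    (Function.fixedPoints (conjZeroLocus I)).ncard = (zeroLocus ℝ I).ncard := by
  have hcast : ∀ (x : σ → ℝ) (p : MvPolynomial σ ℝ),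
      aeval (fun i => (x i : ℂ)) p = ((aeval x p : ℝ) : ℂ) := fun x p =>
    (comp_aeval_apply x Complex.ofRealAm p).symm
  symm
  refine Set.ncard_congr (fun x hx => ⟨fun i => (x i : ℂ), fun p hp => ?_⟩) ?_ ?_ ?_
  · rw [hcast, hx p hp, Complex.ofReal_zero]
  · intro x hx
    exact Subtype.ext (funext fun i => Complex.conj_ofReal _)
  · intro x y hx hy hxy
    funext i
    exact Complex.ofReal_injective (congrFun (congrArg Subtype.val hxy) i)
  · intro v hv
    have hre : ∀ i, ((v.1 i).re : ℂ) = v.1 i := fun i =>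
      Complex.conj_eq_iff_re.1 (congrFun (congrArg Subtype.val hv) i)
    refine ⟨fun i => (v.1 i).re, fun p hp => ?_, Subtype.ext (funext hre)⟩
    apply Complex.ofReal_injective
    rw [← hcast, funext hre]
    exact v.2 p hp

/-- The coefficients are split, not the values: at a non-real `v`, `aeval v a` and `aeval v b` need
not be real. -/
theorem exists_real_imaginary_parts {σ : Type*} (p : MvPolynomial σ ℂ) :
    ∃ a b : MvPolynomial σ ℝ, ∀ v, eval v p = aeval v a + Complex.I * aeval v b := by
  induction p using MvPolynomial.induction_on' with
  | monomial d z =>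
    refine ⟨monomial d z.re, monomial d z.im, fun v => ?_⟩
    rw [eval_monomial, aeval_monomial, aeval_monomial]
    conv_lhs => rw [← Complex.re_add_im z]
    simp only [Complex.coe_algebraMap]
    ring
  | add p q hp hq =>
    obtain ⟨a, b, h⟩ := hp
    obtain ⟨a', b', h'⟩ := hq
    refine ⟨a + a', b + b', fun v => ?_⟩
    rw [map_add, map_add, map_add, h, h']
    ring

variable (I B) in
/-- The sums of the real and the imaginary parts of the values at the complex points. -/
def realCoordinates : (B → ℝ) →ₗ[ℝ] (zeroLocus ℂ I → ℝ) :=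
  LinearMap.pi fun v =>
    (Complex.reLm + Complex.imLm) ∘ₗ (aeval v.1).toLinearMap ∘ₗ monomialCombination ℝ B

theorem realCoordinates_apply (u : B → ℝ) (v : zeroLocus ℂ I) :
    realCoordinates B I u v =
      (aeval v.1 (monomialCombination ℝ B u)).re + (aeval v.1 (monomialCombination ℝ B u)).im :=
  rfl

/-- This explains the choice of coordinates: `(Re z + Im z)(Re z - Im z) = Re z²`, so the product of
the coordinates at `v` and `v̄` is the real part of a squared value. -/
theorem realCoordinates_conj (u : B → ℝ) (v : zeroLocus ℂ I) :
    realCoordinates B I u (conjZeroLocus I v) =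
      (aeval v.1 (monomialCombination ℝ B u)).re - (aeval v.1 (monomialCombination ℝ B u)).im := by
  have h : (conjZeroLocus I v).1 = fun i => starRingEnd ℂ (v.1 i) := rfl
  rw [realCoordinates_apply, h, aeval_conj, Complex.conj_re, Complex.conj_im,
    sub_eq_add_neg]

theorem realCoordinates_surjective (h : IsMonomialBasis I B) (hV : (zeroLocus ℂ I).Finite) :
    Function.Surjective (realCoordinates B I) := by
  classical
  intro r
  -- The conjugation-equivariant values whose real and imaginary parts sum to `r`.
  let c : zeroLocus ℂ I → ℂ := fun v =>
    ⟨(r v + r (conjZeroLocus I v)) / 2, (r v - r (conjZeroLocus I v)) / 2⟩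
  have hc : ∀ v, c (conjZeroLocus I v) = starRingEnd ℂ (c v) := by
    intro v
    apply Complex.ext
    · simp only [c, Complex.conj_re, conjZeroLocus_involutive I v]
      ring
    · simp only [c, Complex.conj_im, conjZeroLocus_involutive I v]
      ring
  obtain ⟨p, hp⟩ := exists_interpolation hV
    fun v => if hv : v ∈ zeroLocus ℂ I then c ⟨v, hv⟩ else 0
  have hp' : ∀ v : zeroLocus ℂ I, eval v.1 p = c v := fun v => by
    rw [hp v.1 v.2, dif_pos v.2]
  obtain ⟨a, b, hab⟩ := exists_real_imaginary_parts p
  -- The interpolating polynomial `a + i b` is complex. Comparing its values at `v` and `v̄` shows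
  -- that `a - i b` also takes the value `c v`, so the real polynomial `a` interpolates `c`.
  have ha : ∀ v : zeroLocus ℂ I, aeval v.1 a = c v := by
    intro v
    have h1 := hab v.1
    have h2 := hab (conjZeroLocus I v).1
    rw [hp'] at h1 h2
    rw [hc] at h2
    have h3 : starRingEnd ℂ (starRingEnd ℂ (c v)) = aeval v.1 a - Complex.I * aeval v.1 b := by
      rw [h2]
      simp only [conjZeroLocus, aeval_conj, map_add, map_mul, Complex.conj_conj, Complex.conj_I]
      ring
    rw [Complex.conj_conj] at h3
    linear_combination -(h1 + h3) / 2
  obtain ⟨u, hu⟩ := h.exists_mk_eq a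
  refine ⟨u, funext fun v => ?_⟩
  have h1 : aeval v.1 (monomialCombination ℝ B u) = c v := by
    rw [← ha v, ← sub_eq_zero, ← map_sub]
    exact v.2 _ (Ideal.Quotient.eq.1 hu)
  rw [realCoordinates_apply, h1]
  simp only [c]
  ring

/-- The signature of the Hermite matrix of a real ideal is the number of its real points. -/
theorem matrixSignature_hermiteMatrix (h : IsMonomialBasis I B) :
    matrixSignature (hermiteMatrix I B) = (zeroLocus ℝ I).ncard := by
  classical
  -- The trace formula needs an algebraically closed field; base change to `ℂ` keeps the monomial
  -- basis and the traces.
  let J := I.map (map (algebraMap ℝ ℂ))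
  have hJ : zeroLocus ℂ J = zeroLocus ℂ I := zeroLocus_map I
  have : Module.Finite ℂ (MvPolynomial (Fin n) ℂ ⧸ J) :=
    .of_basis (specializedBasis (algebraMap ℝ ℂ) h.basis h.basis_apply)
  have hV : (zeroLocus ℂ J).Finite := finite_zeroLocus
  have := hV.fintype
  obtain ⟨μ, hμ, htr⟩ := exists_trace_eq_sum (I := J)
  have hV' : (zeroLocus ℂ I).Finite := hJ ▸ hV
  have := hV'.fintype
  let ν : zeroLocus ℂ I → ℝ := fun v => μ ⟨v.1, hJ.ge v.2⟩
  have hν : ∀ v, 0 < ν v := fun v => Nat.cast_pos.2 (hμ _)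
  have htr' : ∀ p : MvPolynomial (Fin n) ℝ,
      ((LinearMap.trace ℝ _ (LinearMap.mulLeft ℝ (Ideal.Quotient.mk I p)) : ℝ) : ℂ) =
        ∑ v, (ν v : ℂ) * aeval v.1 p := by
    intro p
    have h1 := trace_mulLeft_map (algebraMap ℝ ℂ) h.basis_apply p
    rw [htr] at h1
    rw [Complex.coe_algebraMap] at h1
    rw [← h1]
    refine Fintype.sum_equiv (Equiv.setCongr hJ) _ _ fun v => ?_
    simp only [ν, Equiv.setCongr_apply, Complex.ofReal_natCast]
    rw [eval_map]
    rfl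
  have hQ : (hermiteMatrix I B).toQuadraticForm' =
      (twistedForm ν (conjZeroLocus I)).comp (realCoordinates B I) := by
    ext u
    have h1 : (hermiteMatrix I B).toQuadraticForm' u =
        ∑ b, ∑ c, u b * hermiteMatrix I B b c * u c := by
      rw [Matrix.toQuadraticForm', LinearMap.BilinMap.toQuadraticMap_apply,
        Matrix.toLinearMap₂'_apply]
      refine Finset.sum_congr rfl fun b _ => Finset.sum_congr rfl fun c _ => ?_
      rw [smul_eq_mul, smul_eq_mul]
      ring
    rw [h1, sum_hermiteMatrix, QuadraticMap.comp_apply, twistedForm_apply]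
    -- The trace is real, so only the real parts of the squared values contribute to the sum.
    have h2 := congrArg Complex.re (htr' (monomialCombination ℝ B u * monomialCombination ℝ B u))
    rw [Complex.ofReal_re, Complex.re_sum] at h2
    rw [h2]
    refine Finset.sum_congr rfl fun v _ => ?_
    rw [Complex.re_ofReal_mul, map_mul, Complex.mul_re, realCoordinates_conj,
      realCoordinates_apply]
    ring
  have hL := realCoordinates_surjective h hV'
  rw [matrixSignature, ← ncard_fixedPoints_conjZeroLocus,
    ← sigPos_sub_sigNeg_twistedForm hν (conjZeroLocus_involutive I),
    ← sigPos_comp_of_surjective _ hL, ← sigNeg_comp_of_surjective _ hL, ← hQ]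
  congr!

end Real

end Hermite

/-! ### Specialization of parametric systems -/

section Specialization

variable {t n m : ℕ} {f : Fin m → ParamPoly t n} {𝒢 : Set (ParamPoly t n)}

theorem map_localIdeal {R F : Type*} [CommRing R] [Algebra (MvPolynomial (Fin t) ℚ) R] [CommRing F]
    {φ : R →+* F} {ψ : MvPolynomial (Fin t) ℚ →+* F}
    (h : φ.comp (algebraMap (MvPolynomial (Fin t) ℚ) R) = ψ) :
    (localIdeal f R).map (map φ) = Ideal.span (Set.range fun i => map ψ (f i)) := by
  rw [localIdeal, Ideal.map_map, Ideal.map_span, ← Set.range_comp, ← h]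
  congr 2
  funext i
  exact map_map _ _ _

theorem systemRoots_eq_zeroLocus {F : Type*} [Field F] [Algebra ℚ F] (η : Fin t → F) :
    systemRoots f η = zeroLocus F (specializedIdeal f η) := by
  ext x
  rw [specializedIdeal, zeroLocus_span]
  simp [systemRoots, aeval_eq_eval]

/-! ### Evaluating fractions whose denominators are products of leading coefficients -/

section Lift

variable (R : Type*) [CommRing R] [Algebra (MvPolynomial (Fin t) ℚ) R]

theorem exists_lift_of_leadingCoeff_ne_zero [IsLocalization (leadingSubmonoid 𝒢) R] {F : Type*} [Field F]
    (ψ : MvPolynomial (Fin t) ℚ →+* F) (hψ : ∀ g ∈ 𝒢, ψ ((grevlex n).leadingCoeff g) ≠ 0) :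
    ∃ φ : R →+* F, φ.comp (algebraMap (MvPolynomial (Fin t) ℚ) R) = ψ := by
  have hle : leadingSubmonoid 𝒢 ≤ (IsUnit.submonoid F).comap ψ := by
    refine Submonoid.closure_le.2 ?_
    rintro _ ⟨g, hg, rfl⟩
    exact (hψ g hg).isUnit
  exact ⟨IsLocalization.lift (M := leadingSubmonoid 𝒢) (g := ψ) fun s => hle s.2,
    IsLocalization.lift_comp _⟩

/-- A rational function whose denominator is a product of leading coefficients is defined where
these do not vanish, and its value is given by the universal property. -/
theorem isDefinedAt_and_evalFrac_eq (𝒢 : Set (ParamPoly t n))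
    [IsLocalization (leadingSubmonoid 𝒢) R] {F : Type*} [Field F] [Algebra ℚ F] {η : Fin t → F}
    {φK : R →+* ParamField t} {φ : R →+* F}
    (hK : φK.comp (algebraMap (MvPolynomial (Fin t) ℚ) R) =
      algebraMap (MvPolynomial (Fin t) ℚ) (ParamField t))
    (hφ : φ.comp (algebraMap (MvPolynomial (Fin t) ℚ) R) =
      (aeval η : MvPolynomial (Fin t) ℚ →ₐ[ℚ] F).toRingHom) (h : R) :
    IsDefinedAt η (φK h) ∧ evalFrac η (φK h) = φ h := by
  obtain ⟨⟨a, s⟩, has⟩ := IsLocalization.surj (leadingSubmonoid 𝒢) h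
  have hφ' : ∀ p, φ (algebraMap (MvPolynomial (Fin t) ℚ) R p) = aeval η p := fun p =>
    RingHom.congr_fun hφ p
  have hK' : ∀ p, φK (algebraMap (MvPolynomial (Fin t) ℚ) R p) =
    algebraMap (MvPolynomial (Fin t) ℚ) (ParamField t) p := fun p => RingHom.congr_fun hK p
  have hs : aeval η (s : MvPolynomial (Fin t) ℚ) ≠ 0 := by
    rw [← hφ']
    exact ((IsLocalization.map_units R s).map φ).ne_zero
  set N := IsFractionRing.num (MvPolynomial (Fin t) ℚ) (φK h) with hN
  set D := IsFractionRing.den (MvPolynomial (Fin t) ℚ) (φK h) with hD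
  have hD0 : algebraMap (MvPolynomial (Fin t) ℚ) (ParamField t) D ≠ 0 :=
    IsFractionRing.to_map_ne_zero_of_mem_nonZeroDivisors D.2
  have hND : φK h * algebraMap _ (ParamField t) (D : MvPolynomial (Fin t) ℚ) =
      algebraMap _ (ParamField t) N := by
    have := IsFractionRing.mk'_num_den (MvPolynomial (Fin t) ℚ) (φK h)
    rw [IsLocalization.mk'_eq_iff_eq_mul] at this
    exact this.symm
  have h1 : N * s = a * D := by
    apply IsFractionRing.injective (MvPolynomial (Fin t) ℚ) (ParamField t)
    have h2 := congrArg φK has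
    rw [map_mul, hK', hK'] at h2
    rw [map_mul, map_mul, ← h2, ← hND]
    ring
  -- The reduced denominator divides `N * s` and is coprime to `N`, so it divides `s`, which does
  -- not vanish at `η`.
  have h2 : (D : MvPolynomial (Fin t) ℚ) ∣ s :=
    (IsFractionRing.num_den_reduced (MvPolynomial (Fin t) ℚ) (φK h)).symm.dvd_of_dvd_mul_left
      ⟨a, by rw [h1, mul_comm]⟩
  have hdef : aeval η (D : MvPolynomial (Fin t) ℚ) ≠ 0 := by
    obtain ⟨c, hc⟩ := h2
    rw [hc, map_mul] at hs
    exact left_ne_zero_of_mul hs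
  refine ⟨hdef, ?_⟩
  have h3 := congrArg φ has
  rw [map_mul, hφ', hφ'] at h3
  have h4 := congrArg (aeval η) h1
  rw [map_mul, map_mul, ← h3] at h4
  rw [evalFrac, div_eq_iff hdef]
  refine mul_right_cancel₀ hs ?_
  rw [h4]
  ring

end Lift

/-- The consequences of a common monomial basis at a parameter `η` at which no leading coefficient
vanishes. -/
theorem IsParametricGB.specialize_hermite (h𝒢 : IsParametricGB f 𝒢)
    [Finite (standardMonomials 𝒢)] {F : Type*} [Field F] [Algebra ℚ F] {η : Fin t → F}
    (hη : ∀ g ∈ 𝒢, aeval η ((grevlex n).leadingCoeff g) ≠ 0) :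
    (∀ b c, IsDefinedAt η (paramHermite f 𝒢 b c)) ∧
      (paramHermite f 𝒢).map (evalFrac η) =
        hermiteMatrix (specializedIdeal f η) (standardMonomials 𝒢) := by
  let R := Localization (leadingSubmonoid 𝒢)
  obtain ⟨b, hb⟩ := h𝒢.exists_localBasis R
  obtain ⟨φK, hK⟩ := exists_lift_of_leadingCoeff_ne_zero (𝒢 := 𝒢) R
    (algebraMap (MvPolynomial (Fin t) ℚ) (ParamField t)) fun g hg =>
      IsFractionRing.to_map_ne_zero_of_mem_nonZeroDivisors
        (h𝒢.leadingSubmonoid_le (Submonoid.subset_closure ⟨g, hg, rfl⟩))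
  obtain ⟨φ, hφ⟩ := exists_lift_of_leadingCoeff_ne_zero (𝒢 := 𝒢) R
    (aeval η : MvPolynomial (Fin t) ℚ →ₐ[ℚ] F).toRingHom hη
  -- The common preimage `x` is the trace of the same multiplication on the free `R`-module.
  have key : ∀ c d, ∃ x : R, paramHermite f 𝒢 c d = φK x ∧
      hermiteMatrix (specializedIdeal f η) (standardMonomials 𝒢) c d = φ x := by
    intro c d
    have h1 := trace_mulLeft_map φK hb (monomial c.1 1 * monomial d.1 1)
    have h2 := trace_mulLeft_map φ hb (monomial c.1 1 * monomial d.1 1)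
    rw [map_localIdeal hK, map_mul, map_monomial, map_monomial, φK.map_one] at h1
    rw [map_localIdeal hφ, map_mul, map_monomial, map_monomial, φ.map_one] at h2
    exact ⟨_, h1, h2⟩
  have key' : ∀ c d, IsDefinedAt η (paramHermite f 𝒢 c d) ∧
      evalFrac η (paramHermite f 𝒢 c d) =
        hermiteMatrix (specializedIdeal f η) (standardMonomials 𝒢) c d := by
    intro c d
    obtain ⟨x, h1, h2⟩ := key c d
    rw [h1, h2]
    exact isDefinedAt_and_evalFrac_eq R 𝒢 hK hφ x
  exact ⟨fun c d => (key' c d).1, Matrix.ext fun c d => (key' c d).2⟩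

/-- The standard monomials form a basis after every base change under which no leading coefficient
vanishes. -/
theorem IsParametricGB.isMonomialBasis (h𝒢 : IsParametricGB f 𝒢) {F : Type*} [Field F]
    {ψ : MvPolynomial (Fin t) ℚ →+* F} (hψ : ∀ g ∈ 𝒢, ψ ((grevlex n).leadingCoeff g) ≠ 0) :
    IsMonomialBasis (Ideal.span (Set.range fun i => map ψ (f i))) (standardMonomials 𝒢) := by
  let R := Localization (leadingSubmonoid 𝒢)
  obtain ⟨b, hb⟩ := h𝒢.exists_localBasis R
  obtain ⟨φ, hφ⟩ := exists_lift_of_leadingCoeff_ne_zero (𝒢 := 𝒢) R ψ hψ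
  rw [← map_localIdeal hφ]
  exact isMonomialBasis_of_basis _ (specializedBasis_apply φ hb)

/-- A non-empty Zariski open set contains a point at which no leading coefficient vanishes. -/
theorem IsParametricGB.exists_mem_leadingCoeff_ne_zero (h𝒢 : IsParametricGB f 𝒢)
    {O : Set (Fin t → ℂ)} (hO : IsZariskiOpen O) (hne : O.Nonempty) :
    ∃ η ∈ O, ∀ g ∈ 𝒢, aeval η ((grevlex n).leadingCoeff g) ≠ 0 := by
  obtain ⟨J, rfl⟩ := hO
  obtain ⟨x, hx⟩ := hne
  obtain ⟨q, hq, hqx⟩ : ∃ q ∈ J, aeval x q ≠ 0 := by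
    by_contra! hcon
    exact hx hcon
  -- Finiteness of `𝒢` gathers all conditions into one nonzero polynomial, which is nonzero at some
  -- point because `ℂ` is infinite.
  let p : MvPolynomial (Fin t) ℂ := q * ∏ g ∈ h𝒢.finite.toFinset,
    map (algebraMap ℚ ℂ) ((grevlex n).leadingCoeff g)
  have hp : p ≠ 0 := by
    refine mul_ne_zero (fun h => hqx (by rw [h, map_zero])) (Finset.prod_ne_zero_iff.2 ?_)
    intro g hg h0
    have h1 := map_injective (algebraMap ℚ ℂ) (algebraMap ℚ ℂ).injective (h0.trans (map_zero _).symm)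
    exact (grevlex n).leadingCoeff_ne_zero_iff.2 (h𝒢.ne_zero (h𝒢.finite.mem_toFinset.1 hg)) h1
  obtain ⟨η, hη⟩ : ∃ η, eval η p ≠ 0 := by
    by_contra! hcon
    exact hp (MvPolynomial.funext fun η => by rw [hcon, map_zero])
  rw [map_mul, map_prod] at hη
  refine ⟨η, fun h => left_ne_zero_of_mul hη ?_, fun g hg => ?_⟩
  · rw [← aeval_eq_eval]
    exact h q hq
  · have := Finset.prod_ne_zero_iff.1 (right_ne_zero_of_mul hη) g (h𝒢.finite.mem_toFinset.2 hg)
    rwa [eval_map, ← aeval_def] at this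

end Specialization

/-- A vector space is zero exactly when its bases are empty. Solvability thus becomes a condition on
`B` alone, independent of `η`. -/
theorem nonempty_iff_ne_top_of_isMonomialBasis {n : ℕ} {K : Type*} [Field K]
    {I : Ideal (MvPolynomial (Fin n) K)} {B : Set (Fin n →₀ ℕ)} (h : IsMonomialBasis I B) :
    B.Nonempty ↔ I ≠ ⊤ := by
  rw [← Ideal.Quotient.nontrivial_iff, ← Set.nonempty_coe_sort]
  exact ⟨fun ⟨d⟩ => ⟨_, 0, h.1.ne_zero d⟩, fun _ => (Module.Basis.mk h.1 h.2.ge).index_nonempty⟩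

theorem mainTheorem4 {t n m : ℕ} (f : Fin m → ParamPoly t n) (hf : IsGenericallyFinite f)
    (𝒢 : Set (ParamPoly t n)) (h𝒢 : IsParametricGB f 𝒢) :
    -- the standard monomials are a finite basis of `𝕂[x]/⟨f⟩_𝕂`
    ∃ _ : Fintype (standardMonomials 𝒢),
      IsMonomialBasis (genericIdeal f) (standardMonomials 𝒢) ∧
      (∀ η : Fin t → ℂ, η ∉ WInfty 𝒢 →
        -- `⟨f(η, ·)⟩` is zero-dimensional, with the same monomial basis of the quotient
        (systemRoots f η).Nonempty ∧ (systemRoots f η).Finite ∧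
        IsMonomialBasis (specializedIdeal f η) (standardMonomials 𝒢) ∧
        -- `𝓗(η)` is well defined and is the Hermite matrix of `⟨f(η, ·)⟩`
        (∀ b c, IsDefinedAt η (paramHermite f 𝒢 b c)) ∧
        (paramHermite f 𝒢).map (evalFrac η) =
          hermiteMatrix (specializedIdeal f η) (standardMonomials 𝒢) ∧
        ((paramHermite f 𝒢).map (evalFrac η)).rank = (systemRoots f η).ncard) ∧
      (∀ η : Fin t → ℝ, (fun i => (η i : ℂ)) ∉ WInfty 𝒢 →
        matrixSignature ((paramHermite f 𝒢).map (evalFrac η)) = ((systemRoots f η).ncard : ℤ)) := by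
  obtain ⟨O, hO, hne, hfin⟩ := hf
  obtain ⟨η₀, hη₀, hlc⟩ := h𝒢.exists_mem_leadingCoeff_ne_zero hO hne
  have hB₀ : IsMonomialBasis (specializedIdeal f η₀) (standardMonomials 𝒢) :=
    h𝒢.isMonomialBasis (ψ := (aeval η₀ : MvPolynomial (Fin t) ℚ →ₐ[ℚ] ℂ).toRingHom) hlc
  obtain ⟨hne₀, hfin₀⟩ := hfin η₀ hη₀
  rw [systemRoots_eq_zeroLocus] at hne₀ hfin₀
  -- Finiteness, and then non-emptiness, of `𝓑` is established at `η₀` and serves for every other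
  -- parameter.
  have hfinite : Finite (standardMonomials 𝒢) := by
    have := finite_quotient_of_finite_zeroLocus hfin₀
    exact Module.Finite.finite_basis (Module.Basis.mk hB₀.1 hB₀.2.ge)
  have hnonempty : (standardMonomials 𝒢).Nonempty :=
    (nonempty_iff_ne_top_of_isMonomialBasis hB₀).2 (zeroLocus_nonempty_iff.1 hne₀)
  refine ⟨Fintype.ofFinite _, ?_, fun η hη => ?_, fun η hη => ?_⟩
  · exact h𝒢.isMonomialBasis fun g hg => IsFractionRing.to_map_ne_zero_of_mem_nonZeroDivisors
      (h𝒢.leadingSubmonoid_le (Submonoid.subset_closure ⟨g, hg, rfl⟩))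
  · have hη' : ∀ g ∈ 𝒢, aeval η ((grevlex n).leadingCoeff g) ≠ 0 := fun g hg h0 => hη ⟨g, hg, h0⟩
    have hB : IsMonomialBasis (specializedIdeal f η) (standardMonomials 𝒢) :=
      h𝒢.isMonomialBasis (ψ := (aeval η : MvPolynomial (Fin t) ℚ →ₐ[ℚ] ℂ).toRingHom) hη'
    let : Fintype (standardMonomials 𝒢) := Fintype.ofFinite _
    have := hB.finite
    obtain ⟨h1, h2⟩ := h𝒢.specialize_hermite hη'
    rw [systemRoots_eq_zeroLocus]
    refine ⟨?_, finite_zeroLocus, hB, h1, h2, ?_⟩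
    · exact zeroLocus_nonempty_iff.2 ((nonempty_iff_ne_top_of_isMonomialBasis hB).1 hnonempty)
    · rw [h2]
      exact rank_hermiteMatrix hB
  · have hη' : ∀ g ∈ 𝒢, aeval η ((grevlex n).leadingCoeff g) ≠ 0 := by
      intro g hg h0
      refine hη ⟨g, hg, ?_⟩
      -- Evaluation at a real point commutes with `ℝ → ℂ`, so a leading coefficient vanishing over
      -- `ℝ` would put the point in `WInfty 𝒢`.
      have := comp_aeval_apply η (Complex.ofRealAm.restrictScalars ℚ) ((grevlex n).leadingCoeff g)
      rw [h0, map_zero] at this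
      exact this.symm
    have hB : IsMonomialBasis (specializedIdeal f η) (standardMonomials 𝒢) :=
      h𝒢.isMonomialBasis (ψ := (aeval η : MvPolynomial (Fin t) ℚ →ₐ[ℚ] ℝ).toRingHom) hη'
    rw [(h𝒢.specialize_hermite hη').2, systemRoots_eq_zeroLocus]
    exact @matrixSignature_hermiteMatrix n _ (Fintype.ofFinite _) _ hB

end
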